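/- Conventions. Let $\mathcal A$ be a Grothendieck category and $\mathcal S$ a class of objects of $\mathcal A$. An $\mathcal S$-filtration of an object $X$ consists of an ordinal $\tau$ and subobjects $X_\sigma\subseteq X$ $(\sigma\le\tau)$ such that $X_0=0$, $X_\tau=X$, $X_\mu\subseteq X_\sigma$ for $\mu\le\sigma\le\tau$, $X_\sigma=\sum_{\mu<\sigma}X_\mu$ for limit ordinals $\sigma\le\tau$, and $X_{\sigma+1}/X_\sigma$ is isomorphic to an object of $\mathcal S$ for all $\sigma<\tau$. The class of objects that admit an $\mathcal S$-filtration is denoted $\operatorname{Filt}\mathcal S$. A class $\mathcal F$ of objects is called deconstructible if $\mathcal F=\operatorname{Filt}\mathcal S$ for some set $\mathcal S$. For a regular cardinal $\kappa$, an object $X$ is ${<}\kappa$-presentable if $\operatorname{Hom}(X,-)$ commutes with $\kappa$-filtered colimits; $\mathcal F^{<\kappa}$ denotes the class of ${<}\kappa$-presentable objects in $\mathcal F$. A representative set of a class of objects is a set consisting of exactly one object from each isomorphism class in it. For a monad $\mathbb T$ on $\mathcal A$ and a class $\mathcal F$ of objects of $\mathcal A$, $\mathbb T\text{-}\mathrm{Alg}_{\mathcal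 F}$ denotes the class of $\mathbb T$-algebras whose underlying object lies in $\mathcal F$. If $\mathbb T$ is cocontinuous, then $\mathbb T\text{-}\mathrm{Alg}$ is again a Grothendieck category. Theorem. Let $\mathcal A$ be a Grothendieck category. (1) Let $\kappa$ be an uncountable regular cardinal such that $\mathcal A$ is locally ${<}\kappa$-presentable, let $\mathcal F$ be a class of objects of $\mathcal A$ and $\mathbb T$ a cocontinuous monad on $\mathcal A$ such that $\mathcal F=\operatorname{Filt}\mathcal S$ for a representative set $\mathcal S$ of $\mathcal F^{<\kappa}$, and such that $\mathbb T$ sends ${<}\kappa$-presentable objects to ${<}\kappa$-presentable objects. Then $$\mathbb T\text{-}\mathrm{Alg}_{\mathcal F}=\operatorname{Filt}\left(\mathbb T\text{-}\mathrm{Alg}_{\mathcal S}\right),$$ and $\mathbb T\text{-}\mathrm{Alg}_{\mathcal F}$ is deconstructible. (2) Let $U:\mathcal B\to\mathcal A$ be a cocontinuous monadic functor from a Grothendieck category $\mathcal B$, and let $\mathcal F$ be a deconstructible class of objects of $\mathcal A$. Then $U^{-1}(\mathcal F)=\{X\in\mathcal B \mid U(X)\in\mathcal F\}$ is deconstructible.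 Moreover, there are arbitrarily large uncountable regular cardinals $\kappa$ such that $\mathcal A$ is locally ${<}\kappa$-presentable, the monad on $\mathcal A$ given by $U$ and its left adjoint sends ${<}\kappa$-presentable objects to ${<}\kappa$-presentable objects, and there is a representative set $\mathcal S$ of $\mathcal F^{<\kappa}$ with $\mathcal F=\operatorname{Filt}\mathcal S$ and $$U^{-1}(\mathcal F)=\operatorname{Filt}\{X\in\mathcal B \mid U(X)\text{ is isomorphic to an object of }\mathcal S\}.$$ -/

import Mathlib

open CategoryTheory CategoryTheory.Limits

universe w u u'

namespace Deconstructible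

/-- An `S`-filtration of length `τ` on the object `X` of an abelian category: subobjects `Y σ` of
`X` for `σ ≤ τ` (the values of `Y` beyond `τ` are irrelevant). Sums of subobjects are suprema. -/
structure IsFiltration {C : Type u} [Category.{w} C] [Abelian C] (S : ObjectProperty C) {X : C}
    (τ : Ordinal.{w}) (Y : Ordinal.{w} → Subobject X) : Prop where
  zero : Y 0 = ⊥
  top : Y τ = ⊤
  mono : ∀ μ σ : Ordinal.{w}, μ ≤ σ → σ ≤ τ → Y μ ≤ Y σ
  limit : ∀ σ : Ordinal.{w}, σ ≤ τ → Order.IsSuccLimit σ → IsLUB (Y '' Set.Iio σ) (Y σ)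
  quotient : ∀ (σ : Ordinal.{w}) (hσ : σ < τ),
    ∃ s : C, S s ∧ Nonempty (cokernel (Subobject.ofLE (Y σ) (Y (Order.succ σ))
      (mono σ (Order.succ σ) (Order.le_succ σ) (Order.succ_le_of_lt hσ))) ≅ s)

/-- `Filt S`: the class of objects admitting an `S`-filtration. -/
def filt {C : Type u} [Category.{w} C] [Abelian C] (S : ObjectProperty C) : ObjectProperty C :=
  fun X => ∃ (τ : Ordinal.{w}) (Y : Ordinal.{w} → Subobject X), IsFiltration S τ Y

/-- A class of objects is deconstructible if it is `Filt S` for a (small) set `S`. -/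
def IsDeconstructible {C : Type u} [Category.{w} C] [Abelian C] (F : ObjectProperty C) : Prop :=
  ∃ S : ObjectProperty C, ObjectProperty.Small.{w} S ∧ F = filt S

/-- `S` is a representative set of the objects of the class `P`: a small set of objects of `P`
containing exactly one member of each isomorphism class. -/
structure IsRepresentativeSet {C : Type u} [Category.{w} C] (S P : ObjectProperty C) : Prop where
  small : ObjectProperty.Small.{w} S
  le : S ≤ P
  exists_iso : ∀ X : C, P X → ∃ s : C, S s ∧ Nonempty (X ≅ s)
  eq_of_iso : ∀ s t : C, S s → S t → Nonempty (s ≅ t) → s = t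

/-- `G` sends `κ`-presentable objects to `κ`-presentable objects. -/
def PreservesPresentable {C : Type u} [Category.{w} C] {D : Type u'} [Category.{w} D] (G : C ⥤ D)
    (κ : Cardinal.{w}) [Fact κ.IsRegular] : Prop :=
  ∀ X : C, IsCardinalPresentable X κ → IsCardinalPresentable (G.obj X) κ

section Algebras

variable {A : Type u} [Category.{w} A] [Abelian A] (T : Monad A)
  [PreservesColimitsOfSize.{w, w} T.toFunctor]

instance preservesFiniteColimits_monad : PreservesFiniteColimits T.toFunctor :=
  PreservesColimitsOfSize.preservesFiniteColimits T.toFunctor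

instance additive_monad : T.toFunctor.Additive := by
  have : T.toFunctor.PreservesZeroMorphisms :=
    Functor.preservesZeroMorphisms_of_preserves_initial_object
  have := preservesBinaryBiproducts_of_preservesBinaryCoproducts T.toFunctor
  exact Functor.additive_of_preservesBinaryBiproducts T.toFunctor

instance hasFiniteLimits_algebra : HasFiniteLimits T.Algebra :=
  ⟨fun _ _ _ => ⟨fun D => Monad.hasLimit_of_comp_forget_hasLimit D⟩⟩

instance hasFiniteColimits_algebra : HasFiniteColimits T.Algebra :=
  ⟨fun _ _ _ => ⟨fun D => Monad.forget_creates_colimits_of_monad_preserves D⟩⟩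

instance preservesFiniteLimits_forget : PreservesFiniteLimits T.forget :=
  ⟨fun _ _ _ => inferInstance⟩

instance preservesFiniteColimits_forget : PreservesFiniteColimits T.forget :=
  ⟨fun _ _ _ => inferInstance⟩

theorem isIso_coimageImageComparison_algebra {X Y : T.Algebra} (f : X ⟶ Y) :
    IsIso (Abelian.coimageImageComparison f) := by
  have : IsIso (T.forget.map (Abelian.coimageImageComparison f)) :=
    ((MorphismProperty.isomorphisms A).arrow_mk_iso_iff
      (Abelian.PreservesCoimageImageComparison.iso T.forget f)).2
        (inferInstanceAs (IsIso (Abelian.coimageImageComparison (T.forget.map f))))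
  exact isIso_of_reflects_iso _ T.forget

/-- The category of algebras over a cocontinuous monad on an abelian category is abelian
(for Mathlib's preadditive structure, with addition computed in the base category). -/
noncomputable instance abelianAlgebra : Abelian T.Algebra :=
  have : ∀ {X Y : T.Algebra} (f : X ⟶ Y), IsIso (Abelian.coimageImageComparison f) :=
    isIso_coimageImageComparison_algebra T
  Abelian.ofCoimageImageComparisonIsIso

end Algebras

end Deconstructible

/-! The hard inclusion says that an algebra whose carrier has an `S`-filtration `c` can be filtered
by subalgebras. The argument is a form of the Hill lemma. Choose `κ`-compact subobjects `a i` with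
`c i = (⨆ j < i, c j) ⊔ a i`, and call a set `N` of indices closed if each `a i` with `i ∈ N` meets
the sum of all earlier `a j` inside the sum of the earlier `a j` with `j ∈ N`. Subobject lattices
are modular and continuous along chains. Hence, for closed `N` and `J`, the quotient of the sum over
`N ∪ J` by the sum over `N` is filtered along `J`, each step being zero or one of the original
quotients (`exists_isFamilyFiltration_partialSup`).

Compactness puts every index into a closed set with fewer than `κ` elements. The monad `T` takes
`κ`-compact subobjects to `κ`-compact images, so such a set can be enlarged countably often until
its sum is a subalgebra; it stays small because `κ` is uncountable (`exists_isClosedFor_stable`).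
Sums of these subalgebras filter the algebra. Each successive quotient has a filtration by
`κ`-presentable objects indexed by fewer than `κ` elements, so it is itself `κ`-presentable and in
`filt S` (`filt_inverseImage_forget_of_filt`). The converse inclusion holds because the forgetful
functor is exact and cocontinuous.

For monadic functors, local presentability of Grothendieck categories supplies arbitrarily large
suitable `κ` (`exists_cardinal`), `filt_filt_le` allows the given set to be replaced by a
representative set of `κ`-presentable objects, and the comparison equivalence transports the result.
-/

namespace Deconstructible

/-! ### Subquotients of an object and the correspondence theorem -/

section Quotients


variable {C : Type u} [Category.{v} C] [Abelian C] {X : C}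

/-- The object `s` is a quotient `b / a` of the subobjects `a ≤ b` of `X`. -/
def IsQuotient (a b : Subobject X) (s : C) : Prop :=
  a ≤ b ∧ ∃ p : (b : C) ⟶ s, Epi p ∧
    ∀ ⦃Z : C⦄ (z : Z ⟶ (b : C)), z ≫ p = 0 ↔ a.Factors (z ≫ b.arrow)

omit [Abelian C] in
theorem factors_iff_of_le {a b : Subobject X} (h : a ≤ b) {Z : C} (z : Z ⟶ (b : C)) :
    a.Factors (z ≫ b.arrow) ↔ ∃ y : Z ⟶ (a : C), y ≫ Subobject.ofLE a b h = z := by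
  constructor
  · intro hz
    refine ⟨a.factorThru _ hz, ?_⟩
    rw [← cancel_mono b.arrow]
    simp
  · rintro ⟨y, rfl⟩
    simpa using Subobject.factors_comp_arrow y

theorem isQuotient_cokernel {a b : Subobject X} (h : a ≤ b) :
    IsQuotient a b (cokernel (Subobject.ofLE a b h)) := by
  refine ⟨h, cokernel.π _, inferInstance, fun Z z => ?_⟩
  rw [factors_iff_of_le h]
  constructor
  · intro hz
    exact ⟨Abelian.monoLift _ z hz, Abelian.monoLift_comp _ _ _⟩
  · rintro ⟨y, rfl⟩
    simp

theorem nonempty_iso_of_epi {B s t : C} (p : B ⟶ s) (q : B ⟶ t) [Epi p] [Epi q]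
    (h : ∀ ⦃Z : C⦄ (z : Z ⟶ B), z ≫ p = 0 ↔ z ≫ q = 0) :
    ∃ e : s ≅ t, p ≫ e.hom = q := by
  have h₁ : kernel.ι p ≫ q = 0 := (h _).1 (kernel.condition p)
  have h₂ : kernel.ι q ≫ p = 0 := (h _).2 (kernel.condition q)
  refine ⟨⟨Abelian.epiDesc p q h₁, Abelian.epiDesc q p h₂, ?_, ?_⟩, Abelian.comp_epiDesc _ _ _⟩
  · rw [← cancel_epi p]
    simp
  · rw [← cancel_epi q]
    simp

theorem IsQuotient.nonempty_iso {a b : Subobject X} {s t : C} (hs : IsQuotient a b s)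
    (ht : IsQuotient a b t) : Nonempty (s ≅ t) := by
  obtain ⟨_, p, hp, hp'⟩ := hs
  obtain ⟨_, q, hq, hq'⟩ := ht
  exact ⟨(nonempty_iso_of_epi p q fun Z z => (hp' z).trans (hq' z).symm).choose⟩

theorem IsQuotient.of_iso {a b : Subobject X} {s t : C} (hs : IsQuotient a b s) (e : s ≅ t) :
    IsQuotient a b t := by
  obtain ⟨h, p, hp, hp'⟩ := hs
  refine ⟨h, p ≫ e.hom, epi_comp _ _, fun Z z => ?_⟩
  rw [← hp', ← Category.assoc]
  exact ⟨fun hz => by simpa using congr($hz ≫ e.inv), fun hz => by simp [hz]⟩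

/-- `IsQuotient` involves no morphism depending on a proof of `a ≤ b`, so equal subobjects can be
rewritten in it; this is the passage to the cokernels in `IsFiltration`. -/
theorem isQuotient_iff {a b : Subobject X} (h : a ≤ b) {s : C} :
    IsQuotient a b s ↔ Nonempty (cokernel (Subobject.ofLE a b h) ≅ s) :=
  ⟨fun hs => (isQuotient_cokernel h).nonempty_iso hs,
    fun ⟨e⟩ => (isQuotient_cokernel h).of_iso e⟩

theorem isQuotient_self (a : Subobject X) {s : C} (hs : IsZero s) : IsQuotient a a s :=
  ⟨le_rfl, 0, ⟨fun _ _ _ => hs.eq_of_src _ _⟩, fun _ z =>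
    ⟨fun _ => Subobject.factors_comp_arrow z, fun _ => by simp⟩⟩

/-- The preimage of a subobject of a quotient `s` of `b : Subobject X`, as a subobject of `X`. -/
noncomputable def liftSubobject {b : Subobject X} {s : C} (p : (b : C) ⟶ s) (D : Subobject s) :
    Subobject X :=
  (Subobject.map b.arrow).obj ((Subobject.pullback p).obj D)

omit [Abelian C] in
theorem map_arrow_factors_iff {b : Subobject X} (d : Subobject (b : C)) {Z : C} (z : Z ⟶ X) :
    ((Subobject.map b.arrow).obj d).Factors z ↔ ∃ y : Z ⟶ (b : C), y ≫ b.arrow = z ∧ d.Factors y := by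
  induction d using Subobject.ind with | _ f
  rw [Subobject.map_mk, Subobject.mk_factors_iff]
  constructor
  · rintro ⟨y, rfl⟩
    exact ⟨y ≫ f, Category.assoc _ _ _, (Subobject.mk_factors_iff _ _).2 ⟨y, rfl⟩⟩
  · rintro ⟨y, rfl, hy⟩
    obtain ⟨y', rfl⟩ := (Subobject.mk_factors_iff _ _).1 hy
    exact ⟨y', (Category.assoc _ _ _).symm⟩

theorem liftSubobject_factors_iff {b : Subobject X} {s : C} (p : (b : C) ⟶ s) (D : Subobject s)
    {Z : C} (z : Z ⟶ X) :
    (liftSubobject p D).Factors z ↔ ∃ y : Z ⟶ (b : C), y ≫ b.arrow = z ∧ D.Factors (y ≫ p) := by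
  rw [liftSubobject, map_arrow_factors_iff]
  simp only [pullback_factors_iff]

theorem liftSubobject_comp_factors_iff {b : Subobject X} {s : C} (p : (b : C) ⟶ s)
    (D : Subobject s) {Z : C} (z : Z ⟶ (b : C)) :
    (liftSubobject p D).Factors (z ≫ b.arrow) ↔ D.Factors (z ≫ p) := by
  rw [liftSubobject_factors_iff]
  constructor
  · rintro ⟨y, hy, h⟩
    rwa [(cancel_mono _).1 hy] at h
  · exact fun h => ⟨z, rfl, h⟩

omit [Abelian C] in
theorem le_iff_factors {a b : Subobject X} :
    a ≤ b ↔ ∀ ⦃Z : C⦄ (z : Z ⟶ X), a.Factors z → b.Factors z :=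
  ⟨fun h _ z hz => Subobject.factors_of_le z h hz,
    fun h => Subobject.le_of_factors (h _ (Subobject.factors_self a))⟩

theorem liftSubobject_le {b : Subobject X} {s : C} (p : (b : C) ⟶ s) (D : Subobject s) :
    liftSubobject p D ≤ b := by
  rw [le_iff_factors]
  intro Z z hz
  obtain ⟨y, rfl, -⟩ := (liftSubobject_factors_iff p D z).1 hz
  exact Subobject.factors_comp_arrow y

/-- Membership in `a` is the vanishing of the composite to `X / a`, which can be tested after an
epimorphism. This permits element chases up to refinement. -/
theorem factors_of_epi_comp {a : Subobject X} {Z W : C} (e : W ⟶ Z) [Epi e] {z : Z ⟶ X}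
    (h : a.Factors (e ≫ z)) : a.Factors z := by
  have : z ≫ cokernel.π a.arrow = 0 := by
    rw [← cancel_epi e, ← Category.assoc, ← Subobject.factorThru_arrow a _ h, Category.assoc,
      cokernel.condition, comp_zero, comp_zero]
  rw [← Abelian.monoLift_comp a.arrow z this]
  exact Subobject.factors_comp_arrow _

theorem liftSubobject_le_liftSubobject {b : Subobject X} {s : C} (p : (b : C) ⟶ s) [Epi p]
    {D E : Subobject s} : liftSubobject p D ≤ liftSubobject p E ↔ D ≤ E := by
  constructor
  · intro h
    obtain ⟨A, π, hπ, y, hy⟩ := surjective_up_to_refinements_of_epi p D.arrow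
    refine Subobject.le_of_factors (factors_of_epi_comp π ?_)
    rw [hy, ← liftSubobject_comp_factors_iff]
    refine Subobject.factors_of_le _ h ?_
    rw [liftSubobject_comp_factors_iff, ← hy]
    exact Subobject.factors_comp_arrow π
  · intro h
    rw [le_iff_factors]
    intro Z z hz
    rw [liftSubobject_factors_iff] at hz ⊢
    obtain ⟨y, hy, hD⟩ := hz
    exact ⟨y, hy, Subobject.factors_of_le _ h hD⟩

theorem liftSubobject_top {b : Subobject X} {s : C} (p : (b : C) ⟶ s) :
    liftSubobject p ⊤ = b :=
  le_antisymm (liftSubobject_le p ⊤) (Subobject.le_of_factors (by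
    rw [liftSubobject_factors_iff]
    exact ⟨𝟙 _, by simp, Subobject.top_factors _⟩))

theorem liftSubobject_bot {a b : Subobject X} (hab : a ≤ b) {s : C} (p : (b : C) ⟶ s)
    (hp : ∀ ⦃Z : C⦄ (z : Z ⟶ (b : C)), z ≫ p = 0 ↔ a.Factors (z ≫ b.arrow)) :
    liftSubobject p ⊥ = a := by
  refine le_antisymm ?_ ?_ <;> rw [le_iff_factors] <;> intro Z z hz
  · obtain ⟨y, rfl, h⟩ := (liftSubobject_factors_iff p _ z).1 hz
    rwa [Subobject.bot_factors_iff_zero, hp] at h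
  · rw [liftSubobject_factors_iff]
    have := Subobject.factors_of_le z hab hz
    refine ⟨b.factorThru z this, by simp, ?_⟩
    rw [Subobject.bot_factors_iff_zero, hp]
    simpa

/-- Take the image of `e` in `s`. An element of `b` with the same image as an element of `e` differs
from it by an element of `a ≤ e`. With `liftSubobject_le_liftSubobject`, for `p` epi, this
identifies subobjects of `b / a` with the interval from `a` to `b`. -/
theorem exists_liftSubobject_eq {a b : Subobject X} {s : C} (p : (b : C) ⟶ s)
    (hp : ∀ ⦃Z : C⦄ (z : Z ⟶ (b : C)), z ≫ p = 0 ↔ a.Factors (z ≫ b.arrow))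
    (e : Subobject X) (hae : a ≤ e) (heb : e ≤ b) : ∃ D : Subobject s, liftSubobject p D = e := by
  refine ⟨imageSubobject (Subobject.ofLE e b heb ≫ p), le_antisymm ?_ ?_⟩ <;>
    rw [le_iff_factors] <;> intro Z z hz
  · obtain ⟨y, rfl, h⟩ := (liftSubobject_factors_iff p _ z).1 hz
    obtain ⟨A, π, hπ, x, hx⟩ := surjective_up_to_refinements_of_epi
      (factorThruImageSubobject (Subobject.ofLE e b heb ≫ p)) (Subobject.factorThru _ _ h)
    have hx' := congr($hx ≫ (imageSubobject (Subobject.ofLE e b heb ≫ p)).arrow)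
    simp only [Category.assoc, Subobject.factorThru_arrow, imageSubobject_arrow_comp] at hx'
    have h0 : (π ≫ y - x ≫ Subobject.ofLE e b heb) ≫ p = 0 := by
      simp [Preadditive.sub_comp, hx']
    rw [hp] at h0
    have h1 := Subobject.factors_of_le _ hae h0
    refine factors_of_epi_comp π ?_
    have h2 : e.Factors (x ≫ e.arrow) := Subobject.factors_comp_arrow x
    have := Subobject.factors_add _ _ h1 h2
    simpa [Preadditive.sub_comp] using this
  · rw [liftSubobject_factors_iff]
    refine ⟨e.factorThru z hz ≫ Subobject.ofLE e b heb, by simp, ?_⟩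
    rw [Category.assoc]
    exact imageSubobject_factors_comp_self _ _

/-- Third isomorphism theorem: `p` restricts to an epimorphism from the preimage of `e` onto `e`. -/
theorem IsQuotient.liftSubobject {b : Subobject X} {s : C} (p : (b : C) ⟶ s) [Epi p]
    {d e : Subobject s} {t : C} (h : IsQuotient d e t) :
    IsQuotient (liftSubobject p d) (liftSubobject p e) t := by
  obtain ⟨hde, q, hq, hq'⟩ := h
  have hle := (liftSubobject_le_liftSubobject p).2 hde
  obtain ⟨y, hy, hy'⟩ := (liftSubobject_factors_iff p e _).1
    (Subobject.factors_self (Deconstructible.liftSubobject p e))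
  have hr : e.factorThru (y ≫ p) hy' ≫ e.arrow = y ≫ p := by simp
  have : Epi (e.factorThru (y ≫ p) hy') := by
    rw [epi_iff_surjective_up_to_refinements]
    intro Z z
    obtain ⟨A, π, hπ, x, hx⟩ := surjective_up_to_refinements_of_epi p (z ≫ e.arrow)
    have hf : (Deconstructible.liftSubobject p e).Factors (x ≫ b.arrow) := by
      rw [liftSubobject_comp_factors_iff, ← hx, ← Category.assoc]
      exact Subobject.factors_comp_arrow _
    refine ⟨A, π, hπ, Subobject.factorThru _ _ hf, ?_⟩
    have : Subobject.factorThru _ _ hf ≫ y = x := by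
      rw [← cancel_mono b.arrow, Category.assoc, hy]
      simp
    rw [← cancel_mono e.arrow, Category.assoc, Category.assoc, hr, reassoc_of% this, hx]
  refine ⟨hle, e.factorThru (y ≫ p) hy' ≫ q, epi_comp _ _, fun Z z => ?_⟩
  rw [← Category.assoc, hq', Category.assoc, hr, ← hy, ← Category.assoc, ← Category.assoc,
    liftSubobject_comp_factors_iff]

end Quotients

/-! ### Filtrations indexed by well-ordered sets; `filt` is idempotent -/

section FamilyFiltration

variable {A : Type u} [Category.{w} A] [Abelian A] [IsGrothendieckAbelian.{w} A] {X : A}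

/-- Preimages lie in the interval from `a` to `b`, whose least element is `a`; the summand `a` is
needed when the family is empty. -/
theorem liftSubobject_iSup {a b : Subobject X} {s : A} (hab : a ≤ b) (p : (b : A) ⟶ s) [Epi p]
    (hp : ∀ ⦃Z : A⦄ (z : Z ⟶ (b : A)), z ≫ p = 0 ↔ a.Factors (z ≫ b.arrow))
    {ι : Sort*} (D : ι → Subobject s) :
    liftSubobject p (⨆ k, D k) = a ⊔ ⨆ k, liftSubobject p (D k) := by
  refine le_antisymm ?_ (sup_le ?_ (iSup_le fun k => ?_))
  · obtain ⟨E, hE⟩ := exists_liftSubobject_eq p hp (a ⊔ ⨆ k, liftSubobject p (D k)) le_sup_left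
      (sup_le hab (iSup_le fun k => liftSubobject_le p _))
    rw [← hE, liftSubobject_le_liftSubobject]
    refine iSup_le fun k => ?_
    rw [← liftSubobject_le_liftSubobject p, hE]
    exact le_sup_of_le_right (le_iSup (fun k => liftSubobject p (D k)) k)
  · rw [← liftSubobject_bot hab p hp, liftSubobject_le_liftSubobject]
    exact bot_le
  · rw [liftSubobject_le_liftSubobject]
    exact le_iSup D k

/-- A monotone family of subobjects of `X`, indexed by a well-ordered type, whose union is `X`
and whose successive quotients are in `S`. -/
structure IsFamilyFiltration (S : ObjectProperty A) {I : Type w} [LinearOrder I]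
    (c : I → Subobject X) : Prop where
  mono : Monotone c
  iSup_eq_top : ⨆ i, c i = ⊤
  quotient (i : I) : ∃ s, S s ∧ IsQuotient (⨆ j, ⨆ (_ : j < i), c j) (c i) s

theorem exists_isFamilyFiltration {S : ObjectProperty A} (hX : filt S X) :
    ∃ (I : Type w) (_ : LinearOrder I) (_ : WellFoundedLT I) (c : I → Subobject X),
      IsFamilyFiltration S c := by
  obtain ⟨τ, Y, hY⟩ := hX
  let o (i : τ.ToType) : Ordinal.{w} := (Ordinal.ToType.toOrd i : Set.Iio τ)
  have ho (i : τ.ToType) : o i < τ := (Ordinal.ToType.toOrd i : Set.Iio τ).2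
  have hlt (i j : τ.ToType) : j < i ↔ o j < o i := (Ordinal.ToType.mk.symm.lt_iff_lt).symm
  have hle (i j : τ.ToType) : j ≤ i ↔ o j ≤ o i := (Ordinal.ToType.mk.symm.le_iff_le).symm
  have hsurj (σ : Ordinal.{w}) (hσ : σ < τ) : ∃ i, o i = σ :=
    ⟨Ordinal.ToType.mk ⟨σ, hσ⟩, by simp [o]⟩
  -- The successor stages determine all stages; limit stages are recovered as suprema, which is why
  -- a family filtration needs no limit condition.
  have key (σ : Ordinal.{w}) (hσ : σ ≤ τ) :
      ⨆ j, ⨆ (_ : o j < σ), Y (Order.succ (o j)) = Y σ := by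
    refine le_antisymm (iSup₂_le fun j hj => hY.mono _ _ (Order.succ_le_of_lt hj) hσ) ?_
    have hν (ν : Ordinal.{w}) (h : ν < σ) :
        Y (Order.succ ν) ≤ ⨆ j, ⨆ (_ : o j < σ), Y (Order.succ (o j)) := by
      obtain ⟨j, rfl⟩ := hsurj ν (h.trans_le hσ)
      exact le_iSup₂ (f := fun j (_ : o j < σ) => Y (Order.succ (o j))) j h
    rcases Ordinal.zero_or_succ_or_isSuccLimit σ with rfl | ⟨ν, rfl⟩ | hl
    · rw [hY.zero]
      exact bot_le
    · exact hν ν (Order.lt_succ ν)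
    · refine (hY.limit σ hσ hl).2 ?_
      rintro _ ⟨ν, h, rfl⟩
      exact (hY.mono _ _ (Order.le_succ ν) ((hl.succ_lt h).le.trans hσ)).trans (hν ν h)
  refine ⟨τ.ToType, inferInstance, inferInstance, fun i => Y (Order.succ (o i)),
    ⟨fun i j hij => hY.mono _ _ (Order.succ_le_succ ((hle _ _).1 hij))
      (Order.succ_le_of_lt (ho j)), ?_, fun i => ?_⟩⟩
  · rw [← hY.top, ← key τ le_rfl]
    simp [ho]
  · obtain ⟨s, hs, e⟩ := hY.quotient (o i) (ho i)
    refine ⟨s, hs, ?_⟩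
    simp only [hlt]
    rw [key _ (ho i).le]
    exact (isQuotient_iff _).2 e

/-- The last conjunct lets properties stable under suprema, such as being a subalgebra, pass from
the family to every stage. -/
theorem IsFamilyFiltration.exists_isFiltration {S : ObjectProperty A} {I : Type w} [LinearOrder I]
    [WellFoundedLT I] {c : I → Subobject X} (hc : IsFamilyFiltration S c) :
    ∃ (τ : Ordinal.{w}) (Y : Ordinal.{w} → Subobject X), IsFiltration S τ Y ∧
      ∀ σ, ∃ J : Set I, Y σ = ⨆ j ∈ J, c j := by
  let o (i : I) : Ordinal.{w} := Ordinal.typein (α := I) (· < ·) i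
  have hlt (i j : I) : o j < o i ↔ j < i := Ordinal.typein_lt_typein _
  refine ⟨Ordinal.type (· < · : I → I → Prop), fun σ => ⨆ j, ⨆ (_ : o j < σ), c j,
    ⟨?_, ?_, ?_, ?_, ?_⟩, fun σ => ⟨{j | o j < σ}, rfl⟩⟩
  · simp
  · rw [← hc.iSup_eq_top]
    simp [o, Ordinal.typein_lt_type]
  · exact fun μ σ h _ => iSup₂_le fun j hj =>
      le_iSup₂ (f := fun j (_ : o j < σ) => c j) j (hj.trans_le h)
  · intro σ _ hl
    constructor
    · rintro _ ⟨ν, h, rfl⟩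
      exact iSup₂_le fun j hj =>
        le_iSup₂ (f := fun j (_ : o j < σ) => c j) j (hj.trans h)
    · intro b hb
      refine iSup₂_le fun j hj => ?_
      refine le_trans ?_ (hb ⟨Order.succ (o j), hl.succ_lt hj, rfl⟩)
      exact le_iSup₂ (f := fun k (_ : o k < Order.succ (o j)) => c k) j (Order.lt_succ _)
  · intro σ hσ
    obtain ⟨i, rfl⟩ : ∃ i, o i = σ := Ordinal.typein_surj _ hσ
    obtain ⟨s, hs, h⟩ := hc.quotient i
    refine ⟨s, hs, (isQuotient_iff _).1 ?_⟩
    have h2 : ⨆ j, ⨆ (_ : o j < Order.succ (o i)), c j = c i := by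
      refine le_antisymm (iSup₂_le fun j hj => hc.mono ?_)
        (le_iSup₂ (f := fun k (_ : o k < Order.succ (o i)) => c k) i (Order.lt_succ _))
      rw [Order.lt_succ_iff] at hj
      exact not_lt.1 fun h => hj.not_gt ((hlt _ _).2 h)
    simp only [h2, hlt]
    exact h

theorem IsFamilyFiltration.filt {S : ObjectProperty A} {I : Type w} [LinearOrder I]
    [WellFoundedLT I] {c : I → Subobject X} (hc : IsFamilyFiltration S c) : filt S X := by
  obtain ⟨τ, Y, h, -⟩ := hc.exists_isFiltration
  exact ⟨τ, Y, h⟩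

theorem wellFoundedLT_sigmaLex {ι : Type*} {K : ι → Type*} [LinearOrder ι] [WellFoundedLT ι]
    [∀ i, LinearOrder (K i)] [∀ i, WellFoundedLT (K i)] : WellFoundedLT (Σₗ i, K i) := by
  refine ⟨⟨fun ⟨i, k⟩ => ?_⟩⟩
  induction i using WellFoundedLT.induction with | _ i hi
  induction k using WellFoundedLT.induction with | _ k hk
  refine ⟨_, fun ⟨j, l⟩ h => ?_⟩
  rcases Sigma.Lex.lt_def.1 h with h | ⟨h, h'⟩
  · exact hi j h l
  · obtain rfl : j = i := h
    exact hk l h'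

/-- Pull the filtration of each quotient `s i` back to the interval between `⨆ j < i, c j` and `c
i`, and order all the resulting subobjects lexicographically. -/
theorem filt_filt_le (S : ObjectProperty A) : filt (filt S) ≤ filt S := by
  intro X hX
  obtain ⟨I, _, _, c, hc⟩ := exists_isFamilyFiltration hX
  choose s hs hq using hc.quotient
  choose hle p hp hp' using hq
  choose K _ _ d hd using fun i => exists_isFamilyFiltration (hs i)
  let a (i : I) := ⨆ j, ⨆ (_ : j < i), c j
  let f (k : Σₗ i, K i) : Subobject X := liftSubobject (p (ofLex k).1) (d (ofLex k).1 (ofLex k).2)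
  have hf (k : Σₗ i, K i) : f k ≤ c (ofLex k).1 := liftSubobject_le _ _
  have ha (k : Σₗ i, K i) : a (ofLex k).1 ≤ f k := by
    refine (liftSubobject_bot (hle _) _ (hp' _)).ge.trans ?_
    exact (liftSubobject_le_liftSubobject _).2 bot_le
  have hca (i j : I) (h : j < i) : c j ≤ a i := le_iSup₂ (f := fun j (_ : j < i) => c j) j h
  have hlift (i : I) {ι : Type w} (D : ι → Subobject (s i)) :=
    liftSubobject_iSup (hle i) (p i) (hp' i) D
  have key (i : I) : c i ≤ ⨆ (k : Σₗ i, K i), ⨆ (_ : (ofLex k).1 ≤ i), f k := by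
    induction i using WellFoundedLT.induction with | _ i ih
    conv_lhs => rw [← liftSubobject_top (p i), ← (hd i).iSup_eq_top, hlift]
    refine sup_le (iSup₂_le fun j hj => (ih j hj).trans ?_) (iSup_le fun k => ?_)
    · exact iSup₂_le fun k hk => le_iSup₂ (f := fun (k : Σₗ i, K i) (_ : (ofLex k).1 ≤ i) => f k)
        k (hk.trans hj.le)
    · exact le_iSup₂ (f := fun (k : Σₗ i, K i) (_ : (ofLex k).1 ≤ i) => f k) (toLex ⟨i, k⟩) le_rfl
  have := wellFoundedLT_sigmaLex (K := K)
  refine IsFamilyFiltration.filt (c := f) ⟨?_, ?_, ?_⟩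
  · intro k l hkl
    rcases (Sigma.Lex.le_def).1 hkl with h | ⟨h, h'⟩
    · exact (hf k).trans ((hca _ _ h).trans (ha l))
    · obtain ⟨i, k⟩ := k
      obtain ⟨j, l⟩ := l
      obtain rfl : i = j := h
      exact (liftSubobject_le_liftSubobject _).2 ((hd i).mono h')
  · rw [eq_top_iff, ← hc.iSup_eq_top]
    exact iSup_le fun i => (key i).trans (iSup₂_le fun k _ => le_iSup f k)
  · rintro ⟨i, k⟩
    obtain ⟨t, ht, hq⟩ := (hd i).quotient k
    refine ⟨t, ht, ?_⟩
    have hq' := hq.liftSubobject (p i)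
    rw [iSup_subtype', liftSubobject_iSup (hle i) (p i) (hp' i)] at hq'
    change IsQuotient _ (liftSubobject (p i) (d i k)) t
    convert hq' using 1
    symm
    refine le_antisymm (sup_le (iSup₂_le fun j hj => (key j).trans ?_) (iSup_le fun l => ?_))
      (iSup₂_le fun l hl => ?_)
    · refine iSup₂_le fun l hl => le_iSup₂ (f := fun l (_ : l < _) => f l) l ?_
      exact (Sigma.Lex.lt_def).2 (Or.inl (hl.trans_lt hj))
    · exact le_iSup₂ (f := fun l (_ : l < _) => f l) (toLex ⟨i, l⟩)
        ((Sigma.Lex.lt_def).2 (Or.inr ⟨rfl, l.2⟩))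
    · rcases (Sigma.Lex.lt_def).1 hl with h | ⟨h, h'⟩
      · exact le_sup_of_le_left ((hf l).trans (hca _ _ h))
      · obtain ⟨j, l⟩ := l
        obtain rfl : j = i := h
        exact le_sup_of_le_right (le_iSup (fun l : {l // l < k} =>
          liftSubobject (p j) (d j l)) ⟨l, h'⟩)

end FamilyFiltration

/-! ### Exact cocontinuous functors preserve filtrations -/

section ExactFunctors

variable {C : Type u} [Category.{w} C] [Abelian C] {D : Type u'} [Category.{w} D] [Abelian D]

theorem filt_mono {S S' : ObjectProperty C} (h : S ≤ S'.isoClosure) : filt S ≤ filt S' := by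
  rintro X ⟨τ, Y, hY⟩
  refine ⟨τ, Y, hY.zero, hY.top, hY.mono, hY.limit, fun σ hσ => ?_⟩
  obtain ⟨s, hs, ⟨e⟩⟩ := hY.quotient σ hσ
  obtain ⟨t, ht, ⟨e'⟩⟩ := h s hs
  exact ⟨t, ht, ⟨e ≪≫ e'⟩⟩

theorem filt_isoClosure (S : ObjectProperty C) : filt S.isoClosure = filt S :=
  le_antisymm (filt_mono le_rfl) (filt_mono (S.le_isoClosure.trans S.isoClosure.le_isoClosure))

/-- The image of a subobject under a functor preserving monomorphisms. -/
noncomputable def mapSubobject (G : C ⥤ D) [G.PreservesMonomorphisms] {X : C} (a : Subobject X) :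
    Subobject (G.obj X) :=
  Subobject.mk (G.map a.arrow)

section

variable (G : C ⥤ D) [G.PreservesMonomorphisms] {X : C}

omit [Abelian C] [Abelian D] in
theorem mapSubobject_mk {Z : C} (f : Z ⟶ X) [Mono f] :
    mapSubobject G (Subobject.mk f) = Subobject.mk (G.map f) :=
  Subobject.mk_eq_mk_of_comm _ _ (G.mapIso (Subobject.underlyingIso f)) (by
    rw [Functor.mapIso_hom, ← G.map_comp, Subobject.underlyingIso_hom_comp_eq_mk])

omit [Abelian C] [Abelian D] in
theorem mapSubobject_mono {a b : Subobject X} (h : a ≤ b) : mapSubobject G a ≤ mapSubobject G b :=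
  Subobject.mk_le_mk_of_comm (G.map (Subobject.ofLE a b h)) (by rw [← G.map_comp]; simp)

omit [Abelian C] [Abelian D] in
theorem mapSubobject_top : mapSubobject G (⊤ : Subobject X) = ⊤ := by
  rw [mapSubobject, ← Subobject.isIso_iff_mk_eq_top]
  infer_instance

theorem mapSubobject_bot [G.PreservesZeroMorphisms] : mapSubobject G (⊥ : Subobject X) = ⊥ := by
  rw [mapSubobject, Subobject.mk_eq_bot_iff_zero]
  simp

theorem IsQuotient.map [PreservesFiniteColimits G] [PreservesFiniteLimits G]
    [G.PreservesZeroMorphisms] {a b : Subobject X} {s : C} (h : IsQuotient a b s) :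
    IsQuotient (mapSubobject G a) (mapSubobject G b) (G.obj s) := by
  have hab : a ≤ b := h.1
  obtain ⟨e⟩ := (isQuotient_iff hab).1 h
  have hε (c : Subobject X) : ∃ ε : (mapSubobject G c : D) ≅ G.obj (c : C),
      ε.hom ≫ G.map c.arrow = (mapSubobject G c).arrow :=
    ⟨Subobject.underlyingIso _, Subobject.underlyingIso_hom_comp_eq_mk _⟩
  choose ε hε using hε
  rw [isQuotient_iff (mapSubobject_mono G hab)]
  refine ⟨cokernel.mapIso _ (G.map (Subobject.ofLE a b hab)) (ε a) (ε b) ?_ ≪≫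
      (PreservesCokernel.iso G _).symm ≪≫ G.mapIso e⟩
  rw [← cancel_mono (G.map b.arrow), Category.assoc, Category.assoc, ← G.map_comp,
    Subobject.ofLE_arrow, hε, hε, Subobject.ofLE_arrow]

/-- A supremum is the image of a coproduct: `∐ Y i ⟶ y` is epi. A cocontinuous functor preserves
both the coproduct and this epimorphism. -/
theorem isLUB_mapSubobject [HasCoproducts.{w} C] [PreservesColimitsOfSize.{w, w} G]
    [G.PreservesZeroMorphisms] {ι : Type*} [Small.{w} ι]
    {Y : ι → Subobject X} {y : Subobject X} (h : IsLUB (Set.range Y) y) :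
    IsLUB (Set.range fun i => mapSubobject G (Y i)) (mapSubobject G y) := by
  have hle (i) : Y i ≤ y := h.1 ⟨i, rfl⟩
  constructor
  · rintro _ ⟨i, rfl⟩
    exact mapSubobject_mono G (hle i)
  · intro b hb
    let ε : (∐ fun k : Shrink.{w} ι => (Y ((equivShrink _).symm k) : C)) ⟶ (y : C) :=
      Sigma.desc fun k => Subobject.ofLE _ _ (hle _)
    have : Epi ε := by
      refine Preadditive.epi_of_cancel_zero _ fun {W} g hg => ?_
      have hyk : y ≤ (Subobject.map y.arrow).obj (kernelSubobject g) := by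
        refine h.2 ?_
        rintro _ ⟨i, rfl⟩
        refine Subobject.le_of_factors ?_
        rw [map_arrow_factors_iff]
        refine ⟨Subobject.ofLE _ _ (hle i), by simp, kernelSubobject_factors _ _ ?_⟩
        obtain ⟨k, rfl⟩ := (equivShrink.{w} ι).symm.surjective i
        simpa [ε] using congr(Sigma.ι _ k ≫ $hg)
      obtain ⟨z, hz, hz'⟩ := (map_arrow_factors_iff _ _).1
        (Subobject.factors_of_le _ hyk (Subobject.factors_self y))
      obtain rfl : z = 𝟙 _ := by
        rw [← cancel_mono y.arrow, hz, Category.id_comp]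
      simpa using (kernelSubobject_factors_iff _ _).1 hz'
    refine Subobject.mk_le_of_comm (b.factorThru _ (factors_of_epi_comp (G.map ε) ?_))
      (Subobject.factorThru_arrow _ _ _)
    have key : (G.map ε ≫ G.map y.arrow) ≫ cokernel.π b.arrow = 0 := by
      refine (isColimitOfPreserves G (colimit.isColimit (Discrete.functor
        fun k : Shrink.{w} ι => (Y ((equivShrink _).symm k) : C)))).hom_ext ?_
      rintro ⟨k⟩
      have h1 : Sigma.ι (fun k : Shrink.{w} ι => (Y ((equivShrink _).symm k) : C)) k ≫ ε =
        Subobject.ofLE _ _ (hle _) := by simp [ε]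
      have h2 : b.Factors (G.map (Y ((equivShrink _).symm k)).arrow) :=
        Subobject.factors_of_le _ (hb ⟨_, rfl⟩) (Subobject.mk_factors_self _)
      have h3 : G.map (Y ((equivShrink _).symm k)).arrow ≫ cokernel.π b.arrow = 0 := by
        rw [← Subobject.factorThru_arrow b _ h2, Category.assoc, cokernel.condition, comp_zero]
      change G.map (Sigma.ι _ k) ≫ _ = G.map (Sigma.ι _ k) ≫ _
      rw [comp_zero, ← Category.assoc, ← Category.assoc, ← G.map_comp, h1, ← G.map_comp,
        Subobject.ofLE_arrow, h3]
    rw [← Abelian.monoLift_comp b.arrow _ key]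
    exact Subobject.factors_comp_arrow _

end

theorem filt_map (G : C ⥤ D) [HasCoproducts.{w} C] [PreservesColimitsOfSize.{w, w} G]
    [PreservesFiniteLimits G] {S : ObjectProperty C} {S' : ObjectProperty D}
    (h : ∀ s, S s → S'.isoClosure (G.obj s)) {X : C} (hX : filt S X) : filt S' (G.obj X) := by
  have : PreservesFiniteColimits G := PreservesColimitsOfSize.preservesFiniteColimits G
  have : G.PreservesZeroMorphisms := Functor.preservesZeroMorphisms_of_preserves_initial_object
  obtain ⟨τ, Y, hY⟩ := hX
  rw [← filt_isoClosure]
  refine ⟨τ, fun σ => mapSubobject G (Y σ), ?_, ?_, fun μ σ h h' =>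
    mapSubobject_mono G (hY.mono μ σ h h'), fun σ hσ hl => ?_, fun σ hσ => ?_⟩
  · rw [hY.zero, mapSubobject_bot]
  · rw [hY.top, mapSubobject_top]
  · have := hY.limit σ hσ hl
    rw [Set.image_eq_range] at this ⊢
    exact isLUB_mapSubobject G this
  · obtain ⟨s, hs, e⟩ := hY.quotient σ hσ
    exact ⟨G.obj s, h s hs, (isQuotient_iff _).1 (((isQuotient_iff _).2 e).map G)⟩

end ExactFunctors

/-! ### The lattice-theoretic Hill lemma -/

section Hill


variable {L : Type v} [CompleteLattice L] {I : Type w}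

/-- An element `a` of a complete lattice is `κ`-compact if any cover of `a` by a (small) family
has a subcover of cardinality less than `κ`. -/
def IsCardinalCompact (κ : Cardinal.{w}) (a : L) : Prop :=
  ∀ ⦃ι : Type w⦄ (s : ι → L), a ≤ ⨆ i, s i → ∃ J : Set ι, HasCardinalLT J κ ∧ a ≤ ⨆ i ∈ J, s i

/-- The supremum of the members of the family `A` whose index is in `N`. -/
def partialSup (A : I → L) (N : Set I) : L := ⨆ i ∈ N, A i

theorem le_partialSup (A : I → L) {N : Set I} {i : I} (hi : i ∈ N) : A i ≤ partialSup A N :=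
  le_iSup₂ (f := fun i (_ : i ∈ N) => A i) i hi

theorem partialSup_le {A : I → L} {N : Set I} {b : L} (h : ∀ i ∈ N, A i ≤ b) :
    partialSup A N ≤ b :=
  iSup₂_le h

theorem partialSup_mono (A : I → L) {N M : Set I} (h : N ⊆ M) :
    partialSup A N ≤ partialSup A M :=
  partialSup_le fun _ hi => le_partialSup A (h hi)

theorem partialSup_iUnion (A : I → L) {ι : Sort*} (N : ι → Set I) :
    partialSup A (⋃ k, N k) = ⨆ k, partialSup A (N k) := by
  refine le_antisymm (partialSup_le fun i hi => ?_)
    (iSup_le fun k => partialSup_mono A (Set.subset_iUnion N k))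
  obtain ⟨k, hk⟩ := Set.mem_iUnion.1 hi
  exact (le_partialSup A hk).trans (le_iSup (fun k => partialSup A (N k)) k)

theorem partialSup_union (A : I → L) (N M : Set I) :
    partialSup A (N ∪ M) = partialSup A N ⊔ partialSup A M := by
  refine le_antisymm (partialSup_le ?_) (sup_le (partialSup_mono A Set.subset_union_left)
    (partialSup_mono A Set.subset_union_right))
  rintro i (hi | hi)
  · exact le_sup_of_le_left (le_partialSup A hi)
  · exact le_sup_of_le_right (le_partialSup A hi)

theorem isCardinalCompact_partialSup {κ : Cardinal.{w}} [Fact κ.IsRegular] {A : I → L} {N : Set I}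
    (hA : ∀ i ∈ N, IsCardinalCompact κ (A i)) (hN : HasCardinalLT N κ) :
    IsCardinalCompact κ (partialSup A N) := by
  intro ι s hs
  choose J hJ hJ' using fun i : N => hA i i.2 s ((le_partialSup A i.2).trans hs)
  refine ⟨⋃ i : N, J i, hasCardinalLT_iUnion _ hN hJ, partialSup_le fun i hi => ?_⟩
  refine (hJ' ⟨i, hi⟩).trans (iSup₂_le fun j hj => ?_)
  exact le_iSup₂ (f := fun j (_ : j ∈ ⋃ i : N, J i) => s j) j (Set.mem_iUnion.2 ⟨_, hj⟩)

variable [LinearOrder I]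

/-- Sets `N` of indices such that the relations between the `A i`, for `i ∈ N`, are visible
in `N`. -/
def IsClosedFor (A : I → L) (N : Set I) : Prop :=
  ∀ i ∈ N, A i ⊓ partialSup A (Set.Iio i) ≤ partialSup A (N ∩ Set.Iio i)

theorem IsClosedFor.iUnion {A : I → L} {ι : Sort*} {N : ι → Set I}
    (hN : ∀ k, IsClosedFor A (N k)) : IsClosedFor A (⋃ k, N k) := by
  intro i hi
  obtain ⟨k, hk⟩ := Set.mem_iUnion.1 hi
  exact (hN k i hk).trans (partialSup_mono A (Set.inter_subset_inter_left _
    (Set.subset_iUnion N k)))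

theorem IsClosedFor.union {A : I → L} {N M : Set I} (hN : IsClosedFor A N)
    (hM : IsClosedFor A M) : IsClosedFor A (N ∪ M) := by
  rintro i (hi | hi)
  · exact (hN i hi).trans (partialSup_mono A (Set.inter_subset_inter_left _
      Set.subset_union_left))
  · exact (hM i hi).trans (partialSup_mono A (Set.inter_subset_inter_left _
      Set.subset_union_right))

theorem IsClosedFor.inter {A : I → L} {N D : Set I} (hN : IsClosedFor A N) (hD : IsLowerSet D) :
    IsClosedFor A (N ∩ D) := by
  rintro i ⟨hi, hi'⟩
  refine (hN i hi).trans (partialSup_mono A ?_)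
  rintro j ⟨hj, hj'⟩
  exact ⟨⟨hj, hD (le_of_lt hj') hi'⟩, hj'⟩

variable [WellFoundedLT I]

/-- Transfinite induction on truncations of `N`, with `hL` for the passage to unions. If `j ∈ N`
lies outside `D`, then `D` is below `j`; modularity isolates `A j ⊓ partialSup A (Set.Iio j)`, and
closedness absorbs it into the earlier part of `N`. -/
theorem partialSup_inf_le [IsModularLattice L]
    (hL : ∀ (a : L) (K : Set I) (s : K → L), Monotone s → a ⊓ ⨆ i, s i ≤ ⨆ i, a ⊓ s i)
    {A : I → L} {N D : Set I} (hN : IsClosedFor A N) (hD : IsLowerSet D) :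
    partialSup A D ⊓ partialSup A N ≤ partialSup A (N ∩ D) := by
  have hmono (K : Set I) :
      Monotone fun j : K => partialSup A (N ∩ Set.Iic (j : I)) := fun j k h =>
    partialSup_mono A (Set.inter_subset_inter_right _ (Set.Iic_subset_Iic.2 h))
  have hiU (K : Set I) (hK : ∀ j ∈ N, j ∈ K) :
      partialSup A N ≤ ⨆ j : K, partialSup A (N ∩ Set.Iic (j : I)) :=
    partialSup_le fun j hj => (le_partialSup A (N := N ∩ Set.Iic j) ⟨hj, le_refl j⟩).trans
      (le_iSup (fun j : K => partialSup A (N ∩ Set.Iic (j : I))) ⟨j, hK j hj⟩)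
  have key (j : I) : partialSup A D ⊓ partialSup A (N ∩ Set.Iic j) ≤ partialSup A (N ∩ D) := by
    induction j using WellFoundedLT.induction with | _ j ih
    by_cases hj : j ∈ D
    · exact inf_le_right.trans (partialSup_mono A (Set.inter_subset_inter_right _
        fun k hk => hD hk hj))
    have hDj : D ⊆ Set.Iio j := fun k hk => lt_of_not_ge fun h => hj (hD h hk)
    have h1 : partialSup A D ⊓ partialSup A (N ∩ Set.Iio j) ≤ partialSup A (N ∩ D) := by
      have : partialSup A (N ∩ Set.Iio j) ≤
          ⨆ k : Set.Iio j, partialSup A (N ∩ Set.Iic (k : I)) :=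
        partialSup_le fun k hk => (le_partialSup A (N := N ∩ Set.Iic k) ⟨hk.1, le_refl k⟩).trans
          (le_iSup (fun k : Set.Iio j => partialSup A (N ∩ Set.Iic (k : I))) ⟨k, hk.2⟩)
      exact (inf_le_inf_left _ this).trans ((hL _ _ _ (hmono _)).trans
        (iSup_le fun k => ih k k.2))
    by_cases hjN : j ∈ N
    · have h2 : partialSup A (N ∩ Set.Iic j) ≤ partialSup A (N ∩ Set.Iio j) ⊔ A j := by
        refine partialSup_le fun k hk => ?_
        rcases (show k ≤ j from hk.2).lt_or_eq with h | rfl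
        · exact le_sup_of_le_left (le_partialSup A ⟨hk.1, h⟩)
        · exact le_sup_right
      have h3 : partialSup A (N ∩ Set.Iio j) ≤ partialSup A (Set.Iio j) :=
        partialSup_mono A Set.inter_subset_right
      refine le_trans (le_inf inf_le_left ?_) h1
      calc partialSup A D ⊓ partialSup A (N ∩ Set.Iic j)
          ≤ partialSup A (Set.Iio j) ⊓ (partialSup A (N ∩ Set.Iio j) ⊔ A j) :=
            inf_le_inf (partialSup_mono A hDj) h2
        _ = (partialSup A (N ∩ Set.Iio j) ⊔ A j) ⊓ partialSup A (Set.Iio j) := inf_comm _ _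
        _ = partialSup A (N ∩ Set.Iio j) ⊔ A j ⊓ partialSup A (Set.Iio j) :=
            (sup_inf_assoc_of_le _ h3)
        _ ≤ partialSup A (N ∩ Set.Iio j) := sup_le le_rfl (hN j hjN)
    · refine (inf_le_inf_left _ (partialSup_mono A ?_)).trans h1
      rintro k ⟨hk, hk'⟩
      exact ⟨hk, lt_of_le_of_ne hk' fun h => hjN (h ▸ hk)⟩
  exact (inf_le_inf_left _ (hiU Set.univ fun _ _ => trivial)).trans
    ((hL _ _ _ (hmono _)).trans (iSup_le fun j => key j))

/-- The set `N ∪ (J ∩ Set.Iio i)` is closed and omits `i`, so inside `A i` only its indices below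
`i` count; the converse is closedness of `J` at `i`. Thus adjoining `A i` to the smaller sum yields
the original quotient. -/
theorem inf_partialSup_eq [IsModularLattice L]
    (hL : ∀ (a : L) (K : Set I) (s : K → L), Monotone s → a ⊓ ⨆ i, s i ≤ ⨆ i, a ⊓ s i)
    {A : I → L} {N J : Set I} (hN : IsClosedFor A N) (hJ : IsClosedFor A J) {i : I} (hi : i ∈ J)
    (hi' : i ∉ N) :
    A i ⊓ partialSup A (N ∪ (J ∩ Set.Iio i)) = A i ⊓ partialSup A (Set.Iio i) := by
  refine le_antisymm (le_inf inf_le_left ?_) (le_inf inf_le_left ?_)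
  · refine (inf_le_inf_right _ (le_partialSup A (Set.self_mem_Iic (a := i)))).trans
      ((partialSup_inf_le hL (hN.union (hJ.inter (isLowerSet_Iio i)))
        (isLowerSet_Iic i)).trans (partialSup_mono A ?_))
    rintro j ⟨hj | hj, hj'⟩
    · exact lt_of_le_of_ne hj' fun h => hi' (h ▸ hj)
    · exact hj.2
  · exact (hJ i hi).trans (partialSup_mono A Set.subset_union_right)

/-- Well-founded recursion: fewer than `κ` earlier indices cover the meet, and `i` is adjoined to
the union of closed sets chosen for them. Regularity bounds the union. -/
theorem exists_isClosedFor {κ : Cardinal.{w}} [Fact κ.IsRegular] {A : I → L}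
    (hA : ∀ i, IsCardinalCompact κ (A i ⊓ partialSup A (Set.Iio i))) (i : I) :
    ∃ J : Set I, HasCardinalLT J κ ∧ IsClosedFor A J ∧ i ∈ J := by
  induction i using WellFoundedLT.induction with | _ i ih
  choose C hC hC' hC'' using ih
  obtain ⟨J, hJ, hJ'⟩ := hA i (fun j : Set.Iio i => A j)
    (inf_le_right.trans (partialSup_le fun j hj => le_iSup (fun j : Set.Iio i => A j) ⟨j, hj⟩))
  let U : Set I := ⋃ j : J, C j j.1.2
  have hU : IsClosedFor A U := IsClosedFor.iUnion fun j => hC' _ _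
  refine ⟨{i} ∪ U, ?_, ?_, Or.inl rfl⟩
  · have hκ : Cardinal.aleph0 ≤ κ := Cardinal.IsRegular.aleph0_le Fact.out
    have h1 : HasCardinalLT ({i} : Set I) κ := hasCardinalLT_of_finite _ _ hκ
    exact hasCardinalLT_union hκ h1 (hasCardinalLT_iUnion _ hJ fun j => hC _ _)
  · rintro k (rfl | hk)
    · refine hJ'.trans (iSup₂_le fun j hj => le_partialSup A ⟨Or.inr ?_, j.2⟩)
      exact Set.mem_iUnion.2 ⟨⟨j, hj⟩, hC'' _ _⟩
    · exact (hU k hk).trans (partialSup_mono A (Set.inter_subset_inter_left _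
        Set.subset_union_right))

theorem exists_isClosedFor_superset {κ : Cardinal.{w}} [Fact κ.IsRegular] {A : I → L}
    (hA : ∀ i, IsCardinalCompact κ (A i ⊓ partialSup A (Set.Iio i))) {J : Set I}
    (hJ : HasCardinalLT J κ) :
    ∃ J' : Set I, HasCardinalLT J' κ ∧ IsClosedFor A J' ∧ J ⊆ J' := by
  choose C hC hC' hC'' using exists_isClosedFor hA
  exact ⟨⋃ j : J, C j, hasCardinalLT_iUnion _ hJ fun j => hC _,
    IsClosedFor.iUnion fun j => hC' _, fun j hj => Set.mem_iUnion.2 ⟨⟨j, hj⟩, hC'' j⟩⟩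

/-- Any index lies in a closed set of indices of cardinality less than `κ` whose partial supremum
is stable under a given operator. -/
theorem exists_isClosedFor_stable {κ : Cardinal.{w}} [Fact κ.IsRegular]
    (hκ : Cardinal.aleph0 < κ) {A : I → L}
    (hA : ∀ i, IsCardinalCompact κ (A i ⊓ partialSup A (Set.Iio i)))
    (hA' : ∀ i, IsCardinalCompact κ (A i)) (htop : ⨆ i, A i = ⊤) (t : L → L)
    (ht : ∀ a, IsCardinalCompact κ a → IsCardinalCompact κ (t a))
    (htsup : ∀ s : ℕ → L, t (⨆ n, s n) ≤ ⨆ n, t (s n)) (i : I) :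
    ∃ J : Set I, HasCardinalLT J κ ∧ IsClosedFor A J ∧ i ∈ J ∧
      t (partialSup A J) ≤ partialSup A J := by
  have step (J : {J : Set I // HasCardinalLT J κ}) : ∃ J' : {J : Set I // HasCardinalLT J κ},
      IsClosedFor A J'.1 ∧ t (partialSup A J.1) ≤ partialSup A J'.1 := by
    obtain ⟨K, hK, hK'⟩ := ht _ (isCardinalCompact_partialSup (fun i _ => hA' i) J.2) A
      (by simp [htop])
    obtain ⟨J', h1, h2, h3⟩ := exists_isClosedFor_superset hA hK
    exact ⟨⟨J', h1⟩, h2, hK'.trans (partialSup_mono A h3)⟩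
  choose f hf hf' using step
  obtain ⟨J₀, h0, h0', h0''⟩ := exists_isClosedFor hA i
  -- Each iterate contains enough indices to cover `t` of the previous sum, so the union is stable.
  -- A countable union stays below `κ` because `κ` is regular and uncountable.
  let J (n : ℕ) : {J : Set I // HasCardinalLT J κ} := f^[n] ⟨J₀, h0⟩
  have hJ (n : ℕ) : J (n + 1) = f (J n) := Function.iterate_succ_apply' f n _
  refine ⟨⋃ n, (J n).1, ?_, ?_, Set.mem_iUnion.2 ⟨0, h0''⟩, ?_⟩
  · refine hasCardinalLT_iUnion _ ?_ fun n => (J n).2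
    rw [hasCardinalLT_iff_of_equiv Equiv.ulift.{w}.symm, hasCardinalLT_iff_cardinal_mk_lt]
    simpa using hκ
  · refine IsClosedFor.iUnion fun n => ?_
    cases n with
    | zero => exact h0'
    | succ n => rw [hJ]; exact hf _
  · rw [partialSup_iUnion]
    refine (htsup _).trans (iSup_le fun n => (hf' _).trans ?_)
    rw [← hJ]
    exact le_iSup (fun n => partialSup A (J n).1) (n + 1)

end Hill

/-! ### Second isomorphism theorem and modularity of subobject lattices -/

section Lattice

variable {A : Type u} [Category.{w} A] [Abelian A] {X : A}

theorem factors_iff_comp_cokernel {a : Subobject X} {Z : A} (z : Z ⟶ X) :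
    a.Factors z ↔ z ≫ cokernel.π a.arrow = 0 := by
  constructor
  · intro h
    rw [← Subobject.factorThru_arrow a z h, Category.assoc, cokernel.condition, comp_zero]
  · intro h
    rw [← Abelian.monoLift_comp a.arrow z h]
    exact Subobject.factors_comp_arrow _

theorem imageSubobject_le_iff {a : Subobject X} {Z : A} (z : Z ⟶ X) :
    imageSubobject z ≤ a ↔ a.Factors z := by
  constructor
  · intro h
    refine Subobject.factors_of_le _ h ?_
    simpa using imageSubobject_factors_comp_self z (𝟙 _)
  · intro h
    exact imageSubobject_le z (a.factorThru z h) (by simp)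

theorem epi_ofLE_comp {a c : Subobject X} {t : A} (p : ((a ⊔ c : Subobject X) : A) ⟶ t) [Epi p]
    (hp : Subobject.ofLE a (a ⊔ c) le_sup_left ≫ p = 0) :
    Epi (Subobject.ofLE c (a ⊔ c) le_sup_right ≫ p) := by
  refine Preadditive.epi_of_cancel_zero _ fun {W} g hg => ?_
  rw [← cancel_epi p, comp_zero]
  have hle : a ⊔ c ≤ (Subobject.map (a ⊔ c).arrow).obj (kernelSubobject (p ≫ g)) := by
    refine sup_le ?_ ?_ <;> refine Subobject.le_of_factors ?_ <;> rw [map_arrow_factors_iff]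
    · exact ⟨Subobject.ofLE a _ le_sup_left, by simp, kernelSubobject_factors _ _
        (by rw [reassoc_of% hp, zero_comp])⟩
    · exact ⟨Subobject.ofLE c _ le_sup_right, by simp, kernelSubobject_factors _ _
        (by simpa using hg)⟩
  obtain ⟨y, hy, hy'⟩ := (map_arrow_factors_iff _ _).1
    (Subobject.factors_of_le _ hle (Subobject.factors_self _))
  obtain rfl : y = 𝟙 _ := by
    rw [← cancel_mono (a ⊔ c).arrow, hy, Category.id_comp]
  simpa using (kernelSubobject_factors_iff _ _).1 hy'

theorem isQuotient_sup_iff {a c : Subobject X} {s : A} :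
    IsQuotient a (a ⊔ c) s ↔ IsQuotient (c ⊓ a) c s := by
  have key (t : A) (h : IsQuotient a (a ⊔ c) t) : IsQuotient (c ⊓ a) c t := by
    obtain ⟨h, p, hp, hp'⟩ := h
    have hc : c ≤ a ⊔ c := le_sup_right
    have hz {Z : A} (z : Z ⟶ (c : A)) :
        z ≫ Subobject.ofLE c _ hc ≫ p = 0 ↔ (c ⊓ a).Factors (z ≫ c.arrow) := by
      rw [← Category.assoc, hp', Category.assoc, Subobject.ofLE_arrow, Subobject.inf_factors]
      exact ⟨fun h => ⟨Subobject.factors_comp_arrow z, h⟩, fun h => h.2⟩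
    refine ⟨inf_le_left, Subobject.ofLE c _ hc ≫ p, ?_, fun Z z => hz z⟩
    exact epi_ofLE_comp p ((hp' _).2 (by rw [Subobject.ofLE_arrow]; exact Subobject.factors_self a))
  -- The cokernel of `a ≤ a ⊔ c` is also a quotient of `c` by `c ⊓ a`, so uniqueness of quotients
  -- gives the converse.
  refine ⟨key s, fun h => ?_⟩
  have h0 := isQuotient_cokernel (le_sup_left : a ≤ a ⊔ c)
  obtain ⟨e⟩ := (key _ h0).nonempty_iso h
  exact h0.of_iso e

/-- After refinement an element of `a ⊔ b` is a sum of elements of `a` and `b`; if it lies in `c ≥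
a`, so does its `b`-component. -/
instance isModularLattice_subobject : IsModularLattice (Subobject X) where
  sup_inf_le_assoc_of_le {a} b c h := by
    obtain ⟨-, p, hp, hp'⟩ := isQuotient_cokernel (le_sup_left : a ≤ a ⊔ b)
    rw [le_iff_factors]
    intro Z z hz
    obtain ⟨h1, h2⟩ := (Subobject.inf_factors _).1 hz
    have hb : b ≤ a ⊔ b := le_sup_right
    have := epi_ofLE_comp p
      ((hp' _).2 (by rw [Subobject.ofLE_arrow]; exact Subobject.factors_self a))
    obtain ⟨W, π, hπ, y, hy⟩ := surjective_up_to_refinements_of_epi (Subobject.ofLE b _ hb ≫ p)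
      (Subobject.factorThru _ z h1 ≫ p)
    have h3 : a.Factors (π ≫ z - y ≫ b.arrow) := by
      have : (π ≫ Subobject.factorThru _ z h1 - y ≫ Subobject.ofLE b _ hb) ≫ p = 0 := by
        simpa [Preadditive.sub_comp, sub_eq_zero] using hy
      simpa [Preadditive.sub_comp] using (hp' _).1 this
    have h4 : c.Factors (y ≫ b.arrow) := by
      have := Subobject.factors_right_of_factors_add (P := c) (π ≫ z - y ≫ b.arrow)
        (y ≫ b.arrow) (by simpa using Subobject.factors_of_factors_right π h2)
        (Subobject.factors_of_le _ h h3)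
      exact this
    refine factors_of_epi_comp π ?_
    have h5 : (a ⊔ b ⊓ c).Factors (y ≫ b.arrow) := Subobject.factors_of_le _ le_sup_right
      ((Subobject.inf_factors _).2 ⟨Subobject.factors_comp_arrow y, h4⟩)
    simpa using Subobject.factors_add _ _ (Subobject.factors_of_le _ le_sup_left h3) h5

end Lattice

/-! ### Directed unions in Grothendieck categories -/

section Continuity

variable {A : Type u} [Category.{w} A] [Abelian A] [IsGrothendieckAbelian.{w} A] {X : A}
  {J : Type w} [Preorder J]

/-- The cocone given by the inclusions of the members of a directed family in its supremum. -/
noncomputable def iSupCocone {s : J → Subobject X} (hs : Monotone s) :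
    Cocone (hs.functor ⋙ Subobject.underlying) where
  pt := (⨆ j, s j : Subobject X)
  ι := { app j := Subobject.ofLE (s j) _ (le_iSup s j)
         naturality j k f := by
          rw [← cancel_mono (⨆ j, s j : Subobject X).arrow]
          simpa using! Subobject.underlying_arrow (hs.functor.map f) }

noncomputable def isColimitISupCocone [IsFiltered J] {s : J → Subobject X} (hs : Monotone s) :
    IsColimit (iSupCocone hs) := by
  let F : J ⥤ MonoOver X := hs.functor ⋙ Subobject.representative
  let c : Cocone (F ⋙ MonoOver.forget X) :=
    { pt := Over.mk (⨆ j, s j : Subobject X).arrow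
      ι := { app j := Over.homMk (Subobject.ofLE (s j) _ (le_iSup s j)) (Subobject.ofLE_arrow _)
             naturality j k f := by
              ext
              exact (iSupCocone hs).ι.naturality f } }
  have : Mono c.pt.hom := inferInstanceAs (Mono (⨆ j, s j : Subobject X).arrow)
  have h := IsGrothendieckAbelian.isColimitMapCoconeOfSubobjectMkEqISup F c (by
    refine (Subobject.mk_arrow _).trans (iSup_congr fun j => ?_)
    exact (Subobject.mk_arrow _).symm)
  exact h

/-- Here `a ⊓ s j` is the kernel of `s j ⟶ X / a`. By exactness of filtered colimits these kernels
exhaust the kernel on the union. -/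
theorem inf_iSup_le {s : J → Subobject X} [IsFiltered J] (hs : Monotone s) (a : Subobject X) :
    a ⊓ ⨆ j, s j ≤ ⨆ j, a ⊓ s j := by
  let q := cokernel.π a.arrow
  let g : hs.functor ⋙ Subobject.underlying ⟶ (Functor.const J).obj (cokernel a.arrow) :=
    { app j := (s j).arrow ≫ q
      naturality i j f := by
        simpa using! Subobject.underlying_arrow (hs.functor.map f) =≫ q }
  let f : colimit (kernel g) ⟶ ((⨆ j, s j : Subobject X) : A) := colimit.desc (kernel g)
    ((Cocone.precompose (kernel.ι g)).obj (iSupCocone hs))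
  have : IsConnected J := IsFiltered.isConnected J
  have hex := colim.exact_mapShortComplex
    ((ShortComplex.mk _ _ (kernel.condition g)).exact_of_f_is_kernel (kernelIsKernel g))
    (colimit.isColimit _) (isColimitISupCocone hs) (isColimitConstCocone _ _) f
    ((⨆ j, s j : Subobject X).arrow ≫ q) (fun j => by simp [f])
    (fun j => (Subobject.ofLE_arrow_assoc (le_iSup s j) q).trans (Category.comp_id _).symm)
  have hf : (⨆ j, a ⊓ s j).Factors (f ≫ (⨆ j, s j : Subobject X).arrow) := by
    rw [factors_iff_comp_cokernel]
    refine colimit.hom_ext fun j => ?_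
    let k : (kernel g).obj j ⟶ (s j : A) := (kernel.ι g).app j
    have h1 : colimit.ι (kernel g) j ≫ f = k ≫ Subobject.ofLE (s j) _ (le_iSup s j) :=
      colimit.ι_desc _ _
    have h2 : k ≫ (s j).arrow ≫ q = 0 := NatTrans.congr_app (kernel.condition g) j
    rw [comp_zero, ← Category.assoc, ← factors_iff_comp_cokernel, reassoc_of% h1,
      Subobject.ofLE_arrow]
    refine Subobject.factors_of_le _ (le_iSup (fun j => a ⊓ s j) j)
      ((Subobject.inf_factors _).2 ⟨?_, Subobject.factors_comp_arrow _⟩)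
    rw [factors_iff_comp_cokernel, Category.assoc, h2]
  refine Subobject.le_of_factors ?_
  have hz : (Subobject.ofLE (a ⊓ ⨆ j, s j) _ inf_le_right) ≫
      ((⨆ j, s j : Subobject X).arrow ≫ q) = 0 := by
    rw [← Category.assoc, ← factors_iff_comp_cokernel, Subobject.ofLE_arrow]
    exact Subobject.factors_of_le _ inf_le_left (Subobject.factors_self _)
  obtain ⟨W, π, hπ, (x : W ⟶ colimit (kernel g)), hx⟩ := hex.exact_up_to_refinements _ hz
  refine factors_of_epi_comp π ?_
  have hx' : π ≫ Subobject.ofLE (a ⊓ ⨆ j, s j) _ inf_le_right = x ≫ f := hx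
  have h := congr($hx' ≫ (⨆ j, s j : Subobject X).arrow)
  rw [Category.assoc, Subobject.ofLE_arrow, Category.assoc] at h
  rw [h]
  exact Subobject.factors_of_factors_right x hf

end Continuity

/-! ### Generated, compact and presentable objects -/

section Presentable

variable {A : Type u} [Category.{w} A] [Abelian A] [IsGrothendieckAbelian.{w} A] {X : A}
  (κ : Cardinal.{w}) [Fact κ.IsRegular]

/-- An object is `κ`-generated if it is a quotient of a `κ`-presentable object. -/
def IsCardinalGenerated (Y : A) : Prop :=
  ∃ (P : A) (f : P ⟶ Y), IsCardinalPresentable P κ ∧ Epi f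

variable {κ}

omit [Abelian A] [IsGrothendieckAbelian.{w} A] in
theorem IsCardinalGenerated.of_epi {Y Z : A} (h : IsCardinalGenerated κ Y) (f : Y ⟶ Z) [Epi f] :
    IsCardinalGenerated κ Z := by
  obtain ⟨P, g, hP, hg⟩ := h
  exact ⟨P, g ≫ f, hP, epi_comp _ _⟩

theorem isCardinalPresentable_coproduct {ι : Type w} (hι : HasCardinalLT ι κ) (G : ι → A)
    (hG : ∀ i, IsCardinalPresentable (G i) κ) : IsCardinalPresentable (∐ G) κ := by
  have (k : Discrete ι) : IsCardinalPresentable ((Discrete.functor G).obj k) κ := hG k.as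
  exact isCardinalPresentable_of_isColimit _ (colimit.isColimit (Discrete.functor G)) κ
    ((hasCardinalLT_arrow_discrete_iff κ).2 hι)

theorem isCardinalPresentable_cokernel {P Q : A} (f : P ⟶ Q) (hP : IsCardinalPresentable P κ)
    (hQ : IsCardinalPresentable Q κ) : IsCardinalPresentable (cokernel f) κ := by
  have (k : WalkingParallelPair) : IsCardinalPresentable ((parallelPair f 0).obj k) κ := by
    cases k <;> assumption
  refine isCardinalPresentable_of_isColimit _ (colimit.isColimit (parallelPair f 0)) κ
    (.of_le ?_ (Cardinal.IsRegular.aleph0_le Fact.out))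
  rw [hasCardinalLT_aleph0_iff]
  infer_instance

theorem isCardinalPresentable_biprod {P Q : A} (hP : IsCardinalPresentable P κ)
    (hQ : IsCardinalPresentable Q κ) : IsCardinalPresentable (P ⊞ Q) κ := by
  have (k : Discrete WalkingPair) : IsCardinalPresentable ((pair P Q).obj k) κ := by
    obtain ⟨_ | _⟩ := k <;> assumption
  refine isCardinalPresentable_of_isColimit _ (BinaryBiproduct.isColimit P Q) κ
    (.of_le ?_ (Cardinal.IsRegular.aleph0_le Fact.out))
  rw [hasCardinalLT_aleph0_iff]
  infer_instance

theorem isCardinalPresentable_of_isZero {P : A} (hP : IsZero P) : IsCardinalPresentable P κ := by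
  have h := isCardinalPresentable_coproduct (κ := κ) (ι := PEmpty.{w + 1})
    (hasCardinalLT_of_finite _ _ (Cardinal.IsRegular.aleph0_le Fact.out)) (PEmpty.elim : _ → A)
    (fun i => i.elim)
  have h0 : IsZero (∐ (PEmpty.elim : PEmpty.{w + 1} → A)) :=
    (IsZero.iff_id_eq_zero _).2 (Sigma.hom_ext _ _ fun i => i.elim)
  exact isCardinalPresentable_of_iso (h0.iso hP) κ

/-- The full supremum is the `κ`-filtered union of suprema of fewer than `κ` members; a morphism
from a `κ`-presentable cover of `a` factors through one of them. -/
theorem IsCardinalGenerated.isCardinalCompact {a : Subobject X}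
    (ha : IsCardinalGenerated κ (a : A)) : IsCardinalCompact κ a := by
  intro ι s hs
  obtain ⟨P, f, hP, hf⟩ := ha
  let S (K : CardinalDirectedPoset.SetCardinalLT κ ι) : Subobject X := ⨆ i ∈ K.1, s i
  have hS : Monotone S := fun K K' h => iSup₂_le fun i hi =>
    le_iSup₂ (f := fun i (_ : i ∈ K'.1) => s i) i (h hi)
  have := isFiltered_of_isCardinalFiltered (CardinalDirectedPoset.SetCardinalLT κ ι) κ
  have hle : a ≤ ⨆ K, S K := hs.trans (iSup_le fun i => by
    refine le_trans ?_ (le_iSup S (CardinalDirectedPoset.SetCardinalLT.singleton κ i))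
    exact le_iSup₂ (f := fun j (_ : j ∈ ({i} : Set ι)) => s j) i rfl)
  obtain ⟨K, (g : P ⟶ (S K : A)), hg⟩ := IsCardinalPresentable.exists_hom_of_isColimit κ
    (isColimitISupCocone hS) (f ≫ Subobject.ofLE _ _ hle)
  refine ⟨K.1, K.2, Subobject.le_of_factors (factors_of_epi_comp f ?_)⟩
  have hg' : g ≫ Subobject.ofLE (S K) _ (le_iSup S K) = f ≫ Subobject.ofLE _ _ hle := hg
  have := congr($hg' ≫ (⨆ K, S K).arrow)
  rw [Category.assoc, Category.assoc, Subobject.ofLE_arrow, Subobject.ofLE_arrow] at this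
  rw [← this]
  exact Subobject.factors_comp_arrow g

variable (κ) in
omit [IsGrothendieckAbelian.{w} A] in
theorem exists_cover [IsCardinalLocallyPresentable A κ] (Y : A) :
    ∃ (ι : Type w) (G : ι → A) (g : ∀ i, G i ⟶ Y), (∀ i, IsCardinalPresentable (G i) κ) ∧
      ∀ ⦃W : A⦄ (h : Y ⟶ W), (∀ i, g i ≫ h = 0) → h = 0 := by
  obtain ⟨P, hP, hP', hP''⟩ :=
    (IsCardinalLocallyPresentable.iff_exists_isStrongGenerator A κ).1 inferInstance
  let T := Σ G : Subtype P, (G.1 ⟶ Y)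
  have : Small.{w} T := small_sigma _
  refine ⟨Shrink.{w} T, fun i => ((equivShrink T).symm i).1.1, fun i => ((equivShrink T).symm i).2,
    fun i => hP'' _ ((equivShrink T).symm i).1.2, fun W h hh => ?_⟩
  have hT (t : T) : t.2 ≫ h = 0 := by
    obtain ⟨i, rfl⟩ := (equivShrink T).symm.surjective t
    exact hh i
  exact hP'.isSeparating _ _ fun G hG g => (hT ⟨⟨G, hG⟩, g⟩).trans comp_zero.symm

theorem eq_zero_of_le_iSup {K W : A} (m : K ⟶ X) [Mono m] {ι : Type*}
    {G : ι → A} (g : ∀ i, G i ⟶ K) (hm : Subobject.mk m ≤ ⨆ i, imageSubobject (g i ≫ m))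
    (h : K ⟶ W) (hg : ∀ i, g i ≫ h = 0) : h = 0 := by
  have h1 : Subobject.mk m ≤ Subobject.mk (kernel.ι h ≫ m) := by
    refine hm.trans (iSup_le fun i => ?_)
    rw [imageSubobject_le_iff, Subobject.mk_factors_iff]
    exact ⟨kernel.lift h (g i) (hg i), kernel.lift_ι_assoc _ _ _ _⟩
  have h2 := Subobject.factors_of_le _ h1 (Subobject.mk_factors_self m)
  obtain ⟨(y : K ⟶ kernel h), (hy : y ≫ kernel.ι h ≫ m = m)⟩ := (Subobject.mk_factors_iff _ _).1 h2
  have h3 : y ≫ kernel.ι h = 𝟙 K := by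
    rw [← cancel_mono m, Category.assoc, hy, Category.id_comp]
  rw [← Category.id_comp h, ← h3, Category.assoc, kernel.condition, comp_zero]

theorem top_le_iSup_image {Y : A} {ι : Type*} {G : ι → A} (g : ∀ i, G i ⟶ Y)
    (hg : ∀ ⦃W : A⦄ (h : Y ⟶ W), (∀ i, g i ≫ h = 0) → h = 0) :
    ⊤ ≤ ⨆ i, imageSubobject (g i) := by
  refine Subobject.le_of_factors ?_
  rw [factors_iff_comp_cokernel, hg (cokernel.π (⨆ i, imageSubobject (g i)).arrow), comp_zero]
  intro i
  rw [← factors_iff_comp_cokernel, ← imageSubobject_le_iff]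
  exact le_iSup (fun i => imageSubobject (g i)) i

omit [Fact κ.IsRegular] in
/-- A small cover of a `κ`-compact object restricts to a cover with less than `κ` members. -/
theorem exists_epi_coproduct {Y : A} {ι : Type w} {G : ι → A} (g : ∀ i, G i ⟶ Y)
    (hg : ∀ ⦃W : A⦄ (h : Y ⟶ W), (∀ i, g i ≫ h = 0) → h = 0)
    (hY : IsCardinalCompact κ (⊤ : Subobject Y)) :
    ∃ J : Set ι, HasCardinalLT J κ ∧ Epi (Sigma.desc fun j : J => g j) := by
  obtain ⟨J, hJ, hJ'⟩ := hY _ (top_le_iSup_image g hg)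
  refine ⟨J, hJ, Preadditive.epi_of_cancel_zero _ fun {W} h hh => ?_⟩
  refine eq_zero_of_le_iSup (𝟙 Y) (fun j : J => g j) (le_top.trans (hJ'.trans ?_)) h fun j => ?_
  · exact iSup₂_le fun j hj => by
      refine le_trans ?_ (le_iSup (fun j : J => imageSubobject (g j ≫ 𝟙 Y)) ⟨j, hj⟩)
      simp
  · simpa using congr(Sigma.ι (fun j : J => G j) j ≫ $hh)

omit [Fact κ.IsRegular] in
theorem IsCardinalCompact.top {a : Subobject X} (ha : IsCardinalCompact κ a) :
    IsCardinalCompact κ (⊤ : Subobject (a : A)) := by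
  have hp : ∀ ⦃Z : A⦄ (z : Z ⟶ (a : A)),
      z ≫ 𝟙 (a : A) = 0 ↔ (⊥ : Subobject X).Factors (z ≫ a.arrow) := fun Z z => by
    rw [Subobject.bot_factors_iff_zero, Category.comp_id, ← cancel_mono a.arrow, zero_comp]
  intro ι s hs
  have key {ι' : Type w} (s' : ι' → Subobject (a : A)) :
      ⊤ ≤ ⨆ i, s' i ↔ a ≤ ⨆ i, liftSubobject (𝟙 _) (s' i) := by
    rw [← liftSubobject_le_liftSubobject (𝟙 (a : A)), liftSubobject_top,
      liftSubobject_iSup bot_le _ hp, bot_sup_eq]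
  obtain ⟨J, hJ, hJ'⟩ := ha _ ((key s).1 hs)
  refine ⟨J, hJ, ?_⟩
  rw [iSup_subtype'] at hJ' ⊢
  exact (key fun j : J => s j).2 hJ'

/-- Fewer than `κ` members of a cover by `κ`-presentable objects suffice, and their coproduct is
`κ`-presentable. -/
theorem IsCardinalCompact.isCardinalGenerated [IsCardinalLocallyPresentable A κ] {Y : A}
    (hY : IsCardinalCompact κ (⊤ : Subobject Y)) : IsCardinalGenerated κ Y := by
  obtain ⟨ι, G, g, hG, hg⟩ := exists_cover κ Y
  obtain ⟨J, hJ, hJ'⟩ := exists_epi_coproduct g hg hY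
  exact ⟨_, _, isCardinalPresentable_coproduct hJ _ fun j => hG j, hJ'⟩

end Presentable

/-! ### Extensions and short filtrations of presentable objects -/

section Presentable

variable {A : Type u} [Category.{w} A] [Abelian A] [IsGrothendieckAbelian.{w} A] {X : A}
  {κ : Cardinal.{w}} [Fact κ.IsRegular]

/-- The functor sending an index `j` to the quotient of `X` by the `j`-th member of a monotone
family of subobjects. -/
noncomputable def quotientFunctor {J : Type w} [Preorder J] {s : J → Subobject X}
    (hs : Monotone s) : J ⥤ A where
  obj j := cokernel (s j).arrow
  map {j k} f := cokernel.desc _ (cokernel.π (s k).arrow)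
    ((factors_iff_comp_cokernel _).1
      (Subobject.factors_of_le _ (hs (leOfHom f)) (Subobject.factors_self _)))
  map_id j := by
    rw [← cancel_epi (cokernel.π (s j).arrow)]
    simp
  map_comp {j k l} f g := by
    rw [← cancel_epi (cokernel.π (s j).arrow)]
    simp

/-- The projection of `X` onto its `j`-th quotient. -/
noncomputable def quotientπ {J : Type w} [Preorder J] {s : J → Subobject X} (hs : Monotone s)
    (j : J) : X ⟶ (quotientFunctor hs).obj j :=
  cokernel.π (s j).arrow

instance {J : Type w} [Preorder J] {s : J → Subobject X} (hs : Monotone s) (j : J) :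
    Epi (quotientπ hs j) :=
  inferInstanceAs (Epi (cokernel.π (s j).arrow))

omit [IsGrothendieckAbelian.{w} A] in
theorem quotientπ_map {J : Type w} [Preorder J] {s : J → Subobject X} (hs : Monotone s)
    {j k : J} (f : j ⟶ k) : quotientπ hs j ≫ (quotientFunctor hs).map f = quotientπ hs k :=
  cokernel.π_desc _ _ _

omit [IsGrothendieckAbelian.{w} A] in
theorem comp_quotientπ_eq_zero_iff {J : Type w} [Preorder J] {s : J → Subobject X}
    (hs : Monotone s) (j : J) {Z : A} (z : Z ⟶ X) :
    z ≫ quotientπ hs j = 0 ↔ (s j).Factors z :=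
  (factors_iff_comp_cokernel z).symm

/-- The kernel of an epimorphism between `κ`-presentable objects is `κ`-generated. -/
theorem isCardinalGenerated_kernel [IsCardinalLocallyPresentable A κ] {P Q : A} (p : P ⟶ Q)
    [Epi p] (hP : IsCardinalPresentable P κ) (hQ : IsCardinalPresentable Q κ) :
    IsCardinalGenerated κ (kernel p) := by
  obtain ⟨ι, G, g, hG, hg⟩ := exists_cover κ (kernel p)
  -- `Q` is the `κ`-filtered colimit of the quotients of `P` by sums of fewer than `κ` of the images
  -- covering the kernel.
  let D := CardinalDirectedPoset.SetCardinalLT κ ι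
  let S (M : D) : Subobject P := ⨆ i ∈ M.1, imageSubobject (g i ≫ kernel.ι p)
  have hS : Monotone S := fun M N h => iSup₂_le fun i hi =>
    le_iSup₂ (f := fun i (_ : i ∈ N.1) => imageSubobject (g i ≫ kernel.ι p)) i (h hi)
  have hmem (M : D) (i : ι) (hi : i ∈ M.1) : g i ≫ kernel.ι p ≫ quotientπ hS M = 0 := by
    rw [← Category.assoc, comp_quotientπ_eq_zero_iff, ← imageSubobject_le_iff]
    exact le_iSup₂ (f := fun i (_ : i ∈ M.1) => imageSubobject (g i ≫ kernel.ι p)) i hi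
  have hSp (M : D) : (S M).arrow ≫ p = 0 := by
    rw [← kernelSubobject_factors_iff]
    refine Subobject.factors_of_le _ (iSup₂_le fun i _ => ?_) (Subobject.factors_self _)
    rw [imageSubobject_le_iff, kernelSubobject_factors_iff]
    simp
  have := isFiltered_of_isCardinalFiltered D κ
  let d (M : D) : (quotientFunctor hS).obj M ⟶ Q := cokernel.desc _ p (hSp M)
  have hd (M : D) : quotientπ hS M ≫ d M = p := cokernel.π_desc _ _ _
  let c : Cocone (quotientFunctor hS) :=
    { pt := Q
      ι :=
        { app := d
          naturality M N f := by
            change _ ≫ d N = d M ≫ 𝟙 Q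
            rw [Category.comp_id, ← cancel_epi (quotientπ hS M), ← Category.assoc,
              quotientπ_map, hd, hd] } }
  let M₀ : D := IsFiltered.nonempty.some
  have hcM (M : D) : quotientπ hS M ≫ c.ι.app M = p := hd M
  have htM (t : Cocone (quotientFunctor hS)) (M N : D) :
      quotientπ hS M ≫ t.ι.app M = quotientπ hS N ≫ t.ι.app N := by
    have h (M N : D) (f : M ⟶ N) :
        quotientπ hS M ≫ t.ι.app M = quotientπ hS N ≫ t.ι.app N := by
      rw [← t.w f, ← Category.assoc, quotientπ_map]
    exact (h M _ (IsFiltered.leftToMax M N)).trans (h N _ (IsFiltered.rightToMax M N)).symm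
  have hdesc (t : Cocone (quotientFunctor hS)) :
      kernel.ι p ≫ quotientπ hS M₀ ≫ t.ι.app M₀ = 0 := by
    refine hg _ fun i => ?_
    rw [htM t M₀ (CardinalDirectedPoset.SetCardinalLT.singleton κ i), ← Category.assoc,
      ← Category.assoc, Category.assoc (g i), hmem _ i (Set.mem_singleton i), zero_comp]
  have hc : IsColimit c :=
    { desc t := Abelian.epiDesc p _ (hdesc t)
      fac t M := by
        rw [← cancel_epi (quotientπ hS M), reassoc_of% hcM M, Abelian.comp_epiDesc,
          htM t M₀ M]
      uniq t m hm := by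
        rw [← cancel_epi p, Abelian.comp_epiDesc, ← hm, reassoc_of% hcM M₀] }
  -- The identity of `Q` lifts to a stage `M`. There the projection of `P` and `p ≫ s` agree in the
  -- colimit, hence already at a stage `N`, so the kernel of `p` lies in `S N`.
  obtain ⟨M, s, (hs : s ≫ c.ι.app M = 𝟙 Q)⟩ :=
    IsCardinalPresentable.exists_hom_of_isColimit κ hc (𝟙 Q)
  obtain ⟨N, f, hf⟩ := IsCardinalPresentable.exists_eq_of_isColimit' κ hc
    (quotientπ hS M) (p ≫ s) (by rw [hcM, Category.assoc, hs, Category.comp_id])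
  rw [quotientπ_map] at hf
  have hle : Subobject.mk (kernel.ι p) ≤ ⨆ i : N.1, imageSubobject (g i ≫ kernel.ι p) := by
    have : (S N).Factors (kernel.ι p) := by
      rw [← comp_quotientπ_eq_zero_iff hS, hf, Category.assoc, kernel.condition_assoc, zero_comp]
    have h := (imageSubobject_le_iff _).2 this
    rw [imageSubobject_mono] at h
    exact h.trans (iSup_subtype'' N.1 fun i => imageSubobject (g i ≫ kernel.ι p)).ge
  refine ⟨_, Sigma.desc fun i : N.1 => g i,
    isCardinalPresentable_coproduct N.2 _ fun i => hG i,
    Preadditive.epi_of_cancel_zero _ fun {W} h hh => ?_⟩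
  exact eq_zero_of_le_iSup (kernel.ι p) (fun i : N.1 => g i) hle h fun i => by
    simpa using congr(Sigma.ι (fun j : N.1 => G j) i ≫ $hh)

/-- If `Q` is a `κ`-presentable quotient of `Y`, there is a morphism from a `κ`-presentable object
to `Y` whose composition with `Y ⟶ Q` is an epimorphism. -/
theorem exists_presentable_hom_epi [IsCardinalLocallyPresentable A κ] {Y Q : A} (p : Y ⟶ Q)
    [Epi p] (hQ : IsCardinalPresentable Q κ) :
    ∃ (P : A) (r : P ⟶ Y), IsCardinalPresentable P κ ∧ Epi (r ≫ p) := by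
  obtain ⟨ι, G, g, hG, hg⟩ := exists_cover κ Y
  have hQ' : IsCardinalGenerated κ ((⊤ : Subobject Q) : A) :=
    ⟨Q, inv (⊤ : Subobject Q).arrow, hQ, inferInstance⟩
  obtain ⟨J, hJ, hJ'⟩ := exists_epi_coproduct (fun i => g i ≫ p) (fun W h hh => by
    rw [← cancel_epi p, comp_zero]
    exact hg _ fun i => by simpa using hh i) hQ'.isCardinalCompact
  refine ⟨_, Sigma.desc fun j : J => g j, isCardinalPresentable_coproduct hJ _ fun j => hG j, ?_⟩
  convert hJ' using 1
  exact Sigma.hom_ext _ _ fun j => by simp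

/-- If `P ⟶ Y` covers `Q` and `P'` covers the kernel of `P ⟶ Q`, then `Y` is the cokernel of a
morphism `P' ⟶ Z ⊞ P` between `κ`-presentable objects. -/
theorem isCardinalPresentable_of_shortExact [IsCardinalLocallyPresentable A κ] {Y Z Q : A}
    (f : Z ⟶ Y) (p : Y ⟶ Q) [Epi p] (hf : f ≫ p = 0)
    (hf' : ∀ ⦃W : A⦄ (z : W ⟶ Y), z ≫ p = 0 → ∃ y, y ≫ f = z)
    [Mono f] (hZ : IsCardinalPresentable Z κ) (hQ : IsCardinalPresentable Q κ) :
    IsCardinalPresentable Y κ := by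
  obtain ⟨P, r, hP, hr⟩ := exists_presentable_hom_epi p hQ
  obtain ⟨P', e, hP', he⟩ := isCardinalGenerated_kernel (r ≫ p) hP hQ
  obtain ⟨s, hs⟩ := hf' (e ≫ kernel.ι (r ≫ p) ≫ r) (by simp)
  let d : Z ⊞ P ⟶ Y := biprod.desc f r
  let k : P' ⟶ Z ⊞ P := biprod.lift (-s) (e ≫ kernel.ι (r ≫ p))
  have hkd : k ≫ d = 0 := by simp [k, d, hs]
  have hd : Epi d := by
    refine Preadditive.epi_of_cancel_zero _ fun {W} h hh => ?_
    have h1 : f ≫ h = 0 := by simpa [d] using congr(biprod.inl ≫ $hh)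
    have h2 : r ≫ h = 0 := by simpa [d] using congr(biprod.inr ≫ $hh)
    have h3 : kernel.ι p ≫ h = 0 := by
      obtain ⟨y, hy⟩ := hf' (kernel.ι p) (kernel.condition p)
      rw [← hy, Category.assoc, h1, comp_zero]
    rw [← Abelian.comp_epiDesc p h h3] at h2 ⊢
    rw [← Category.assoc] at h2
    rw [zero_of_epi_comp (r ≫ p) h2, comp_zero]
  have hex : ∀ ⦃W : A⦄ (z : W ⟶ Z ⊞ P), z ≫ cokernel.π k = 0 ↔ z ≫ d = 0 := by
    intro W z
    constructor
    · intro hz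
      rw [← cokernel.π_desc k d hkd, ← Category.assoc, hz, zero_comp]
    · intro hz
      have h1 : z ≫ biprod.fst ≫ f + z ≫ biprod.snd ≫ r = 0 := by
        rw [← hz]
        simp [d, biprod.desc_eq]
      have h2 : (z ≫ biprod.snd) ≫ r ≫ p = 0 := by
        have := congr($h1 ≫ p)
        simpa [hf] using this
      obtain ⟨V, π, hπ, x, hx⟩ := surjective_up_to_refinements_of_epi e (kernel.lift _ _ h2)
      have h3 : x ≫ e ≫ kernel.ι (r ≫ p) = π ≫ z ≫ biprod.snd := by
        rw [← Category.assoc, ← hx, Category.assoc, kernel.lift_ι]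
      have h4 : π ≫ z = x ≫ k := by
        ext
        · rw [← cancel_mono f]
          have h5 : x ≫ s ≫ f = π ≫ z ≫ biprod.snd ≫ r := by
            rw [hs, ← Category.assoc e, ← Category.assoc x, h3]
            simp
          have h6 := congr(π ≫ $h1)
          rw [Preadditive.comp_add, comp_zero, ← h5] at h6
          simpa [k] using eq_neg_of_add_eq_zero_left h6
        · simp [k, h3]
      rw [← cancel_epi π, ← Category.assoc, h4, Category.assoc, cokernel.condition, comp_zero,
        comp_zero]
  obtain ⟨i, -⟩ := nonempty_iso_of_epi (cokernel.π k) d hex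
  have := isCardinalPresentable_cokernel k hP' (isCardinalPresentable_biprod hZ hP)
  exact isCardinalPresentable_of_iso i κ

theorem IsQuotient.isCardinalPresentable [IsCardinalLocallyPresentable A κ] {a b : Subobject X}
    {s : A} (h : IsQuotient a b s) (ha : IsCardinalPresentable (a : A) κ)
    (hs : IsCardinalPresentable s κ) : IsCardinalPresentable (b : A) κ := by
  obtain ⟨hab, p, hp, hp'⟩ := h
  refine isCardinalPresentable_of_shortExact (Subobject.ofLE a b hab) p ?_ (fun W z hz => ?_) ha hs
  · rw [hp', Subobject.ofLE_arrow]
    exact Subobject.factors_self a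
  · exact (factors_iff_of_le hab z).1 ((hp' z).1 hz)

/-- An object with a filtration of length less than `κ` with `κ`-presentable quotients is
`κ`-presentable. -/
theorem IsFamilyFiltration.isCardinalPresentable [IsCardinalLocallyPresentable A κ] {I : Type w}
    [LinearOrder I] [WellFoundedLT I] (hI : HasCardinalLT I κ) {c : I → Subobject X}
    (hc : IsFamilyFiltration (isCardinalPresentable A κ) c) : IsCardinalPresentable X κ := by
  have hsup (K : Set I) (hK : ∀ i ∈ K, IsCardinalPresentable (c i : A) κ) :
      IsCardinalPresentable ((⨆ i : K, c i : Subobject X) : A) κ := by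
    rcases isEmpty_or_nonempty K with h | h
    · rw [iSup_of_empty]
      exact isCardinalPresentable_of_isZero ((isZero_zero A).of_iso Subobject.botCoeIsoZero)
    · have hs : Monotone fun i : K => c i := fun i j h => hc.mono h
      have (k : K) : IsCardinalPresentable ((hs.functor ⋙ Subobject.underlying).obj k) κ :=
        hK k k.2
      have : IsFiltered K := inferInstance
      refine isCardinalPresentable_of_isColimit _ (isColimitISupCocone hs) κ ?_
      have hK' : HasCardinalLT K κ := hI.of_injective _ Subtype.val_injective
      -- A preorder has at most one arrow between two objects, so its arrows embed into pairs of
      -- objects.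
      refine (hasCardinalLT_prod (Cardinal.IsRegular.aleph0_le Fact.out) hK' hK').of_injective
        (fun f => (f.left, f.right)) ?_
      rintro ⟨i, j, f⟩ ⟨i', j', f'⟩ h
      simp only [Prod.mk.injEq] at h
      obtain ⟨rfl, rfl⟩ := h
      obtain rfl : f = f' := Subsingleton.elim _ _
      rfl
  have key (i : I) : IsCardinalPresentable (c i : A) κ := by
    induction i using WellFoundedLT.induction with | _ i ih
    obtain ⟨s, hs, hq⟩ := hc.quotient i
    refine hq.isCardinalPresentable ?_ hs
    rw [iSup_subtype']
    exact hsup (Set.Iio i) ih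
  have h := hsup Set.univ fun i _ => key i
  have h' : ⨆ i : (Set.univ : Set I), c i = ⊤ := by
    rw [← hc.iSup_eq_top]
    exact le_antisymm (iSup_le fun i => le_iSup c i)
      (iSup_le fun i => le_iSup (fun i : (Set.univ : Set I) => c i) ⟨i, trivial⟩)
  rw [h'] at h
  exact isCardinalPresentable_of_iso (asIso (⊤ : Subobject X).arrow) κ

/-- Take for `c` the image of a `κ`-presentable `P ⟶ b` that covers `s`. Then `c ⊓ a` is the image
of the kernel of `P ⟶ s`, which is `κ`-generated. -/
theorem IsQuotient.exists_sup_eq [IsCardinalLocallyPresentable A κ] {a b : Subobject X} {s : A}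
    (h : IsQuotient a b s) (hs : IsCardinalPresentable s κ) :
    ∃ c : Subobject X, a ⊔ c = b ∧ IsCardinalCompact κ c ∧ IsCardinalCompact κ (c ⊓ a) := by
  obtain ⟨hab, p, hp, hp'⟩ := h
  obtain ⟨P, r, hP, hr⟩ := exists_presentable_hom_epi p hs
  let m := r ≫ b.arrow
  have hc : IsCardinalGenerated κ (imageSubobject m : A) :=
    ⟨P, factorThruImageSubobject m, hP, inferInstance⟩
  have hcb : imageSubobject m ≤ b :=
    (imageSubobject_le_iff _).2 (Subobject.factors_comp_arrow r)
  refine ⟨imageSubobject m, le_antisymm (sup_le hab hcb) ?_, hc.isCardinalCompact,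
    IsCardinalGenerated.isCardinalCompact ?_⟩
  · obtain ⟨W, π, hπ, x, hx⟩ := surjective_up_to_refinements_of_epi (r ≫ p) p
    have h1 : a.Factors ((π - x ≫ r) ≫ b.arrow) := by
      rw [← hp', Preadditive.sub_comp, hx, Category.assoc, sub_self]
    have h2 : (imageSubobject m).Factors (x ≫ m) := imageSubobject_factors_comp_self m x
    refine Subobject.le_of_factors (factors_of_epi_comp π ?_)
    have := Subobject.factors_add _ _ (Subobject.factors_of_le _ (le_sup_left (b := imageSubobject m)) h1)
      (Subobject.factors_of_le _ (le_sup_right (a := a)) h2)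
    simpa [m, Preadditive.sub_comp] using this
  · have hk : (imageSubobject m ⊓ a).Factors (kernel.ι (r ≫ p) ≫ m) := by
      refine (Subobject.inf_factors _).2 ⟨imageSubobject_factors_comp_self m _, ?_⟩
      rw [← Category.assoc, ← hp', Category.assoc, kernel.condition]
    have : Epi (Subobject.factorThru _ _ hk) := by
      rw [epi_iff_surjective_up_to_refinements]
      intro W z
      obtain ⟨V, π, hπ, x, hx⟩ := surjective_up_to_refinements_of_epi
        (factorThruImageSubobject m) (z ≫ Subobject.ofLE _ _ inf_le_left)
      have hx' : π ≫ z ≫ (imageSubobject m ⊓ a).arrow = (x ≫ r) ≫ b.arrow := by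
        have := congr($hx ≫ (imageSubobject m).arrow)
        simpa [m] using this
      have h0 : x ≫ r ≫ p = 0 := by
        rw [← Category.assoc, hp', ← hx', ← Category.assoc]
        exact Subobject.factors_of_le _ inf_le_right (Subobject.factors_comp_arrow _)
      refine ⟨V, π, hπ, kernel.lift _ x h0, ?_⟩
      rw [← cancel_mono (imageSubobject m ⊓ a).arrow, Category.assoc, hx', Category.assoc, Category.assoc,
        Subobject.factorThru_arrow, kernel.lift_ι_assoc]
    exact (isCardinalGenerated_kernel (r ≫ p) hP hs).of_epi (Subobject.factorThru _ _ hk)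

end Presentable

/-! ### Grothendieck categories are locally presentable -/

section Rank

variable {A : Type u} [Category.{w} A] [Abelian A] [IsGrothendieckAbelian.{w} A]

/-- A morphism from `G` to a sufficiently filtered colimit lifts along an epimorphism onto `G` to
some stage of the diagram. -/
theorem exists_epi_lift {G : A} {J : Type w} [SmallCategory J] {Y : J ⥤ A} {c : Cocone Y}
    (hc : IsColimit c) {κ : Cardinal.{w}} [Fact κ.IsRegular] [IsCardinalFiltered J κ]
    (hG : HasCardinalLT (Subobject G) κ) (z : G ⟶ c.pt) :
    ∃ (j : J) (E : A) (r : E ⟶ Y.obj j) (q : E ⟶ G), Epi q ∧ r ≫ c.ι.app j = q ≫ z := by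
  have := isFiltered_of_isCardinalFiltered J κ
  let E : J ⥤ A := pullback c.ι ((Functor.const J).map z)
  let q : E ⟶ (Functor.const J).obj G := pullback.snd _ _
  let r : E ⟶ Y := pullback.fst _ _
  have hqr : r ≫ c.ι = q ≫ (Functor.const J).map z := pullback.condition
  let s (j : J) : Subobject G := imageSubobject (q.app j)
  have hs {j k : J} (f : j ⟶ k) : s j ≤ s k := by
    rw [imageSubobject_le_iff]
    have h : E.map f ≫ q.app k = q.app j := (q.naturality f).trans (Category.comp_id _)
    rw [← h]
    exact imageSubobject_factors_comp_self _ _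
  have hq : ⊤ ≤ ⨆ j, s j := top_le_iSup_image (fun j => q.app j) fun W h hh => by
    have := IsGrothendieckAbelian.IsPresentable.surjectivity.epi_f hc z
    rw [← cancel_epi (IsGrothendieckAbelian.IsPresentable.surjectivity.f z), comp_zero]
    refine colimit.hom_ext fun j => ?_
    rw [comp_zero, ← Category.assoc, IsGrothendieckAbelian.IsPresentable.surjectivity.hf]
    exact hh j
  have hsur : Function.Surjective (fun j : J => (⟨s j, j, rfl⟩ : Set.range s)) := by
    rintro ⟨_, j, rfl⟩
    exact ⟨j, rfl⟩
  -- There may be many stages, but fewer than `κ` distinct images in `G`. One stage per image is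
  -- chosen, and a common upper bound has image all of `G`.
  obtain ⟨σ, hσ⟩ := hsur.hasRightInverse
  have hr : HasCardinalLT (Set.range s) κ := hG.of_injective _ Subtype.val_injective
  let k := IsCardinalFiltered.max σ hr
  have hk : s k = ⊤ := by
    rw [← top_le_iff]
    refine hq.trans (iSup_le fun j => ?_)
    exact (congrArg Subtype.val (hσ ⟨s j, j, rfl⟩)).ge.trans
      (hs (IsCardinalFiltered.toMax σ hr ⟨s j, j, rfl⟩))
  refine ⟨k, E.obj k, r.app k, q.app k, ?_, NatTrans.congr_app hqr k⟩
  refine Preadditive.epi_of_cancel_zero _ fun {W} h hh => ?_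
  have h1 : s k ≤ kernelSubobject h :=
    (imageSubobject_le_iff _).2 ((kernelSubobject_factors_iff _ _).2 hh)
  have h2 := (kernelSubobject_factors_iff h (𝟙 G)).1
    (Subobject.factors_of_le _ h1 (hk ▸ Subobject.top_factors _))
  rwa [Category.id_comp] at h2

/-- Every epimorphism onto a separator `G` restricts to an epimorphism from a quotient of the
coproduct of copies of `G` indexed by the subobjects of `G`. -/
theorem exists_epi_coproduct_subobject {G E : A} (hG : IsSeparator G) (q : E ⟶ G) [Epi q] :
    ∃ m : (∐ fun _ : Shrink.{w} (Subobject G) => G) ⟶ E, Epi (m ≫ q) := by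
  classical
  -- One morphism is kept for each image in `G`, so the coproduct does not depend on `E` and a
  -- single `κ` serves every `E`.
  let g (a : Subobject G) : G ⟶ E :=
    if h : ∃ g : G ⟶ E, imageSubobject (g ≫ q) = a then h.choose else 0
  refine ⟨Sigma.desc fun i => g ((equivShrink _).symm i),
    Preadditive.epi_of_cancel_zero _ fun {W} h hh => ?_⟩
  have h1 (a : Subobject G) : g a ≫ q ≫ h = 0 := by
    have := congr(Sigma.ι (fun _ : Shrink.{w} (Subobject G) => G) (equivShrink _ a) ≫ $hh)
    simpa using this
  rw [← cancel_epi q, comp_zero]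
  refine (isSeparator_def G).1 hG _ _ fun f => ?_
  have h2 : ∃ g : G ⟶ E, imageSubobject (g ≫ q) = imageSubobject (f ≫ q) := ⟨f, rfl⟩
  have h3 : imageSubobject (g (imageSubobject (f ≫ q)) ≫ q) = imageSubobject (f ≫ q) := by
    simp only [g, dif_pos h2]
    exact h2.choose_spec
  have h4 : imageSubobject (f ≫ q) ≤ kernelSubobject h := by
    rw [← h3, imageSubobject_le_iff, kernelSubobject_factors_iff, Category.assoc, h1]
  rw [imageSubobject_le_iff, kernelSubobject_factors_iff] at h4
  rw [comp_zero, ← h4, Category.assoc]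

/-- A separator `G` of a Grothendieck category is `κ`-presentable if `κ` is larger than the set of
subobjects of `G` and than the set of morphisms from `G` to a suitable coproduct of copies of
`G`. -/
theorem isCardinalPresentable_separator {G : A} (hG : IsSeparator G) (κ : Cardinal.{w})
    [Fact κ.IsRegular] (hκ : HasCardinalLT (Subobject G) κ)
    (hκ' : HasCardinalLT (G ⟶ ∐ fun _ : Shrink.{w} (Subobject G) => G) κ) :
    IsCardinalPresentable G κ where
  preservesColimitOfShape J _ _ := ⟨fun {Y} => ⟨fun {c} hc => ⟨by
    have := isFiltered_of_isCardinalFiltered J κ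
    refine Types.FilteredColimit.isColimitOf' _ _ (fun z : G ⟶ c.pt => ?_)
      (IsGrothendieckAbelian.IsPresentable.injectivity hc hκ)
    obtain ⟨j, E, r, q, hq, hrq⟩ := exists_epi_lift hc hκ z
    obtain ⟨m, hm⟩ := exists_epi_coproduct_subobject hG q
    -- `K` lists the morphisms from `G` into the kernel of `m ≫ q`. Each dies at some stage of `Y`;
    -- as there are fewer than `κ`, one stage `l` kills them all, and `z` then descends along `m ≫
    -- q` to `l`.
    let K := {n : G ⟶ ∐ fun _ : Shrink.{w} (Subobject G) => G // n ≫ m ≫ q = 0}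
    have hK : HasCardinalLT K κ := hκ'.of_injective _ Subtype.val_injective
    have hex (n : K) : ∃ (k : J) (f : j ⟶ k), (n.1 ≫ m ≫ r) ≫ Y.map f = 0 := by
      refine IsGrothendieckAbelian.IsPresentable.injectivity₀ hc hκ _ ?_
      rw [Category.assoc, Category.assoc, hrq, ← Category.assoc m, ← Category.assoc, n.2, zero_comp]
    choose k f hf using hex
    obtain ⟨l, a, b, hab⟩ := IsCardinalFiltered.wideSpan f hK
    have h0 : kernel.ι (m ≫ q) ≫ m ≫ r ≫ Y.map b = 0 := by
      refine (isSeparator_def G).1 hG _ _ fun x => ?_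
      let n : K := ⟨x ≫ kernel.ι (m ≫ q), by rw [Category.assoc, kernel.condition, comp_zero]⟩
      have h1 : (n.1 ≫ m ≫ r) ≫ Y.map b = 0 := by
        rw [← hab n, Y.map_comp, ← Category.assoc, hf, zero_comp]
      simpa [n] using h1
    refine ⟨l, Abelian.epiDesc (m ≫ q) _ h0, ?_⟩
    change z = Abelian.epiDesc (m ≫ q) _ h0 ≫ c.ι.app l
    rw [← cancel_epi (m ≫ q), ← Category.assoc, Abelian.comp_epiDesc, Category.assoc,
      Category.assoc, Category.assoc, c.w, hrq]⟩⟩⟩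

variable (A) in
/-- A Grothendieck category is locally presentable. -/
theorem isLocallyPresentable : IsLocallyPresentable.{w} A where
  exists_cardinal := by
    let G := separator A
    have hG : IsSeparator G := isSeparator_separator A
    obtain ⟨κ, hκ, h⟩ := HasCardinalLT.exists_regular_cardinal.{w}
      (Subobject G ⊕ (G ⟶ ∐ fun _ : Shrink.{w} (Subobject G) => G))
    have : Fact κ.IsRegular := ⟨hκ⟩
    refine ⟨κ, inferInstance,
      (IsCardinalLocallyPresentable.iff_exists_isStrongGenerator A κ).2
        ⟨ObjectProperty.singleton G, inferInstance, ?_, ?_⟩⟩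
    · refine ⟨hG, fun X a ha => ?_⟩
      rw [← top_le_iff]
      refine Subobject.le_of_factors ?_
      rw [factors_iff_comp_cokernel]
      rw [← cancel_epi (inv (⊤ : Subobject X).arrow), IsIso.inv_hom_id_assoc, comp_zero]
      refine (isSeparator_def G).1 hG _ _ fun x => ?_
      rw [comp_zero, ← factors_iff_comp_cokernel]
      exact ha G ((ObjectProperty.singleton_iff _ _).2 rfl) x
    · rintro _ ⟨⟩
      exact isCardinalPresentable_separator hG κ (h.of_injective _ Sum.inl_injective)
        (h.of_injective _ Sum.inr_injective)

end Rank

/-! ### Faithful exact functors reflect filtrations -/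

section Reflect

variable {C : Type u} [Category.{w} C] [Abelian C] {D : Type u'} [Category.{w} D] [Abelian D]
  (G : C ⥤ D) [G.Faithful] [G.PreservesMonomorphisms] [G.PreservesZeroMorphisms]

/-- If the image of `a` lies in that of `b`, then `G` kills `a ⟶ X / b`, and faithfulness makes this
morphism zero. -/
theorem mapSubobject_le_mapSubobject_iff {X : C} {a b : Subobject X} :
    mapSubobject G a ≤ mapSubobject G b ↔ a ≤ b := by
  refine ⟨fun h => Subobject.le_of_factors ?_, mapSubobject_mono G⟩
  obtain ⟨(y : G.obj (a : C) ⟶ G.obj (b : C)), (hy : y ≫ G.map b.arrow = G.map a.arrow)⟩ :=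
    (Subobject.mk_factors_iff _ _).1
      (Subobject.factors_of_le _ h (Subobject.mk_factors_self (G.map a.arrow)))
  rw [factors_iff_comp_cokernel]
  refine G.map_injective ?_
  rw [G.map_comp, ← hy, Category.assoc, ← G.map_comp, cokernel.condition, G.map_zero, comp_zero,
    G.map_zero]

theorem mapSubobject_injective {X : C} :
    Function.Injective (mapSubobject G : Subobject X → Subobject (G.obj X)) := fun _ _ h =>
  le_antisymm ((mapSubobject_le_mapSubobject_iff G).1 h.le)
    ((mapSubobject_le_mapSubobject_iff G).1 h.ge)

omit [G.PreservesZeroMorphisms] in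
theorem IsFiltration.of_mapSubobject [PreservesFiniteColimits G] [PreservesFiniteLimits G]
    {S : ObjectProperty D} {X : C} {τ : Ordinal.{w}} {Y : Ordinal.{w} → Subobject X}
    (h : IsFiltration S τ fun σ => mapSubobject G (Y σ)) :
    IsFiltration (S.isoClosure.inverseImage G) τ Y := by
  have : G.PreservesZeroMorphisms := Functor.preservesZeroMorphisms_of_preserves_initial_object
  refine ⟨mapSubobject_injective G (h.zero.trans (mapSubobject_bot G).symm),
    mapSubobject_injective G (h.top.trans (mapSubobject_top G).symm),
    fun μ σ h₁ h₂ => (mapSubobject_le_mapSubobject_iff G).1 (h.mono μ σ h₁ h₂),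
    fun σ hσ hl => ?_, fun σ hσ => ?_⟩
  · refine IsLUB.of_image (fun {a b} => mapSubobject_le_mapSubobject_iff G) ?_
    rw [Set.image_image]
    exact h.limit σ hσ hl
  · have hle : Y σ ≤ Y (Order.succ σ) := (mapSubobject_le_mapSubobject_iff G).1
      (h.mono σ _ (Order.le_succ σ) (Order.succ_le_of_lt hσ))
    obtain ⟨s, hs, e⟩ := h.quotient σ hσ
    exact ⟨_, ⟨s, hs, ((isQuotient_cokernel hle).map G).nonempty_iso ((isQuotient_iff _).2 e)⟩,
      ⟨Iso.refl _⟩⟩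

end Reflect

theorem IsCardinalGenerated.imageSubobject {A : Type u} [Category.{w} A] [Abelian A]
    {κ : Cardinal.{w}} [Fact κ.IsRegular] {Z X : A} (hZ : IsCardinalGenerated κ Z) (m : Z ⟶ X) :
    IsCardinalGenerated κ (Limits.imageSubobject m : A) :=
  hZ.of_epi (factorThruImageSubobject m)

/-! ### Subalgebras and the action of the monad on subobjects -/

section Algebras

variable {A : Type u} [Category.{w} A] {T : Monad A}

/-- A subobject of the carrier of an algebra that is stable under the structure morphism. -/
def IsStable (X : T.Algebra) (a : Subobject X.A) : Prop :=
  a.Factors (T.map a.arrow ≫ X.a)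

namespace IsStable

variable {X : T.Algebra} {a : Subobject X.A} (ha : IsStable X a)

theorem factorThru_arrow :
    a.factorThru _ ha ≫ a.arrow = T.map a.arrow ≫ X.a :=
  Subobject.factorThru_arrow _ _ _

/-- The subalgebra with the given stable carrier. -/
noncomputable def algebra : T.Algebra where
  A := (a : A)
  a := a.factorThru _ ha
  unit := by
    have h : T.η.app (a : A) ≫ T.map a.arrow ≫ X.a = a.arrow := by
      have := T.η.naturality a.arrow
      dsimp at this
      rw [← Category.assoc, ← this, Category.assoc, X.unit, Category.comp_id]
    rw [← cancel_mono a.arrow, Category.assoc, ha.factorThru_arrow, h]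
    exact (Category.id_comp _).symm
  assoc := by
    rw [← cancel_mono a.arrow, Category.assoc, Category.assoc, ha.factorThru_arrow,
      ← Category.assoc (T.map _), ← T.map_comp, ha.factorThru_arrow, T.map_comp, Category.assoc,
      ← X.assoc, ← Category.assoc, ← Category.assoc]
    congr 1
    exact (T.μ.naturality a.arrow).symm

/-- The inclusion of the subalgebra with the given stable carrier. -/
noncomputable def ι : ha.algebra ⟶ X where
  f := a.arrow
  h := ha.factorThru_arrow.symm

instance : Mono ha.ι :=
  have : Mono (T.forget.map ha.ι) := inferInstanceAs (Mono a.arrow)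
  T.forget.mono_of_mono_map this

end IsStable

theorem exists_mapSubobject_forget_eq [T.forget.PreservesMonomorphisms] {X : T.Algebra}
    {a : Subobject X.A} (ha : IsStable X a) : ∃ b : Subobject X, mapSubobject T.forget b = a :=
  ⟨Subobject.mk ha.ι, (mapSubobject_mk T.forget ha.ι).trans (Subobject.mk_arrow a)⟩

variable (T) in
-- The algebra structure is transported along the isomorphism of carriers.
theorem isoClosure_inverseImage_forget_le (S : ObjectProperty A) :
    S.isoClosure.inverseImage T.forget ≤ (S.inverseImage T.forget).isoClosure := by
  rintro X ⟨s, hs, ⟨e⟩⟩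
  have e : X.A ≅ s := e
  let Z : T.Algebra :=
    { A := s
      a := T.map e.inv ≫ X.a ≫ e.hom
      unit := by
        have := T.η.naturality e.inv
        dsimp at this
        rw [← reassoc_of% this, X.unit_assoc, e.inv_hom_id]
      assoc := by
        have := T.μ.naturality e.inv
        dsimp at this
        simp only [T.map_comp, Category.assoc]
        rw [← reassoc_of% this, X.assoc_assoc, ← Category.assoc (T.map e.hom), ← T.map_comp,
          e.hom_inv_id, T.map_id, Category.id_comp] }
  exact ⟨Z, hs, ⟨Monad.Algebra.isoMk e (by
    change T.map e.hom ≫ T.map e.inv ≫ X.a ≫ e.hom = X.a ≫ e.hom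
    rw [← Category.assoc, ← T.map_comp, e.hom_inv_id, T.map_id, Category.id_comp])⟩⟩

variable [Abelian A]

/-- Stable stages are carriers of subalgebras, and the forgetful functor is exact and faithful, so
it reflects the filtration. -/
theorem filt_inverseImage_forget [PreservesColimitsOfSize.{w, w} T.toFunctor]
    {S : ObjectProperty A} {X : T.Algebra} {τ : Ordinal.{w}} {Y : Ordinal.{w} → Subobject X.A}
    (hY : IsFiltration S τ Y) (hY' : ∀ σ, IsStable X (Y σ)) :
    filt (S.inverseImage T.forget) X := by
  choose Z hZ using fun σ => exists_mapSubobject_forget_eq (hY' σ)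
  obtain rfl : (fun σ => mapSubobject T.forget (Z σ)) = Y := funext hZ
  exact filt_mono (isoClosure_inverseImage_forget_le T S) _ ⟨τ, Z, hY.of_mapSubobject⟩

section

variable (X : T.Algebra)

/-- The image of `T a` in `X`, for a subobject `a` of the carrier of the algebra `X`. -/
noncomputable def algebraImage (a : Subobject X.A) : Subobject X.A :=
  imageSubobject (T.map a.arrow ≫ X.a)

theorem algebraImage_le_iff {a b : Subobject X.A} :
    algebraImage X a ≤ b ↔ b.Factors (T.map a.arrow ≫ X.a) :=
  imageSubobject_le_iff _

theorem isStable_iff {a : Subobject X.A} : IsStable X a ↔ algebraImage X a ≤ a :=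
  (algebraImage_le_iff X).symm

variable [IsGrothendieckAbelian.{w} A] [PreservesColimitsOfSize.{w, w} T.toFunctor]

/-- `T` preserves the coproduct of the `s i` and its epimorphism onto the supremum. -/
theorem algebraImage_iSup_le {ι : Type w} (s : ι → Subobject X.A) :
    algebraImage X (⨆ i, s i) ≤ ⨆ i, algebraImage X (s i) := by
  rw [algebraImage_le_iff, factors_iff_comp_cokernel]
  let ε : (∐ fun i => (s i : A)) ⟶ (⨆ i, s i : Subobject X.A) :=
    Sigma.desc fun i => Subobject.ofLE _ _ (le_iSup s i)
  have hε (i : ι) : Sigma.ι (fun i => (s i : A)) i ≫ ε = Subobject.ofLE _ _ (le_iSup s i) :=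
    Sigma.ι_desc _ _
  have : Epi ε := Preadditive.epi_of_cancel_zero _ fun {W} h hh => by
    refine eq_zero_of_le_iSup (⨆ i, s i).arrow (fun i => Subobject.ofLE _ _ (le_iSup s i)) ?_ h
      fun i => ?_
    · rw [Subobject.mk_arrow]
      refine iSup_mono fun i => ?_
      rw [Subobject.ofLE_arrow, imageSubobject_mono, Subobject.mk_arrow]
    · rw [← hε, Category.assoc, hh, comp_zero]
  have : Epi (T.map ε) := inferInstanceAs (Epi (T.toFunctor.map ε))
  rw [← cancel_epi (T.map ε), comp_zero]
  refine (isColimitOfPreserves T.toFunctor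
    (colimit.isColimit (Discrete.functor fun i => (s i : A)))).hom_ext ?_
  rintro ⟨i⟩
  change T.map (Sigma.ι (fun i => (s i : A)) i) ≫ _ = T.map (Sigma.ι (fun i => (s i : A)) i) ≫ _
  rw [comp_zero, ← Category.assoc, ← Category.assoc, ← Category.assoc, ← T.map_comp, ← T.map_comp,
    hε, Subobject.ofLE_arrow, ← factors_iff_comp_cokernel, ← algebraImage_le_iff]
  exact le_iSup (fun i => algebraImage X (s i)) i

theorem IsStable.iSup {ι : Type w} {s : ι → Subobject X.A} (hs : ∀ i, IsStable X (s i)) :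
    IsStable X (⨆ i, s i) :=
  (isStable_iff X).2 ((algebraImage_iSup_le X s).trans
    (iSup_mono fun i => (isStable_iff X).1 (hs i)))

/-- A `κ`-presentable `P` covers `a`; then `T P` is `κ`-presentable and covers the image of `T a`.
-/
theorem IsCardinalCompact.algebraImage {κ : Cardinal.{w}} [Fact κ.IsRegular]
    [IsCardinalLocallyPresentable A κ] (hT : PreservesPresentable T.toFunctor κ)
    {a : Subobject X.A} (ha : IsCardinalCompact κ a) :
    IsCardinalCompact κ (algebraImage X a) := by
  obtain ⟨P, f, hP, hf⟩ := ha.top.isCardinalGenerated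
  have : Epi (T.map f) := inferInstanceAs (Epi (T.toFunctor.map f))
  exact (IsCardinalGenerated.imageSubobject ⟨T.obj P, T.map f, hT P hP, this⟩ _).isCardinalCompact

end

end Algebras

/-! ### Filtering an algebra by subalgebras -/

section Main

variable {A : Type u} [Category.{w} A] [Abelian A] [IsGrothendieckAbelian.{w} A]

theorem inf_iSup_le_of_linearOrder {X : A} {I : Type w} [LinearOrder I] (a : Subobject X)
    (K : Set I) (s : K → Subobject X) (hs : Monotone s) : a ⊓ ⨆ i, s i ≤ ⨆ i, a ⊓ s i := by
  rcases isEmpty_or_nonempty K with h | h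
  · simp
  · exact inf_iSup_le hs a

/-- The quotient of `⨆ i ∈ N ∪ J, a i` by `⨆ i ∈ N, a i`, for closed sets of indices `N` and `J`,
has a filtration indexed by `J`. -/
theorem exists_isFamilyFiltration_partialSup {X : A} {S : ObjectProperty A}
    (hS : ∀ Z, IsZero Z → S Z) {I : Type w} [LinearOrder I] [WellFoundedLT I]
    {a : I → Subobject X}
    (ha : ∀ i, ∃ s, S s ∧ IsQuotient (a i ⊓ partialSup a (Set.Iio i)) (a i) s)
    {N J : Set I} (hN : IsClosedFor a N) (hJ : IsClosedFor a J) :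
    ∃ (Q : A) (d : J → Subobject Q), IsFamilyFiltration S d ∧
      IsQuotient (partialSup a N) (partialSup a (N ∪ J)) Q := by
  have hab := partialSup_mono a (Set.subset_union_left : N ⊆ N ∪ J)
  obtain ⟨-, p, hp, hp'⟩ := isQuotient_cokernel hab
  let f (k : J) : Subobject X := partialSup a (N ∪ (J ∩ Set.Iic (k : I)))
  have hf (k : J) : f k ≤ partialSup a (N ∪ J) :=
    partialSup_mono a (Set.union_subset_union_right _ Set.inter_subset_left)
  have hf' (k : J) : partialSup a N ≤ f k := partialSup_mono a Set.subset_union_left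
  choose d hd using fun k => exists_liftSubobject_eq p hp' (f k) (hf' k) (hf k)
  refine ⟨_, d, ⟨fun j k hjk => ?_, ?_, fun k => ?_⟩, hab, p, hp, hp'⟩
  · rw [← liftSubobject_le_liftSubobject p, hd, hd]
    exact partialSup_mono a (Set.union_subset_union_right _
      (Set.inter_subset_inter_right _ (Set.Iic_subset_Iic.2 hjk)))
  · rw [← top_le_iff, ← liftSubobject_le_liftSubobject p, liftSubobject_top,
      liftSubobject_iSup hab p hp']
    refine partialSup_le ?_
    rintro i (hi | hi)
    · exact le_sup_of_le_left (le_partialSup a hi)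
    · refine le_sup_of_le_right (le_trans ?_ (le_iSup _ (⟨i, hi⟩ : J)))
      rw [hd]
      exact le_partialSup a (Or.inr ⟨hi, le_refl i⟩)
  · let g := partialSup a (N ∪ (J ∩ Set.Iio (k : I)))
    let e := ⨆ j, ⨆ (_ : j < k), d j
    have he : liftSubobject p e = g := by
      have h1 : liftSubobject p e =
          partialSup a N ⊔ ⨆ j, (partialSup a N ⊔ ⨆ (_ : j < k), f j) := by
        simp only [e, liftSubobject_iSup hab p hp', hd]
      rw [h1]
      refine le_antisymm (sup_le (partialSup_mono a Set.subset_union_left) (iSup_le fun j =>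
        sup_le (partialSup_mono a Set.subset_union_left) (iSup_le fun hj =>
          partialSup_mono a (Set.union_subset_union_right _ (Set.inter_subset_inter_right _
            fun i hi => lt_of_le_of_lt hi hj))))) (partialSup_le ?_)
      rintro i (hi | ⟨hi, hik⟩)
      · exact le_sup_of_le_left (le_partialSup a hi)
      · refine le_sup_of_le_right (le_trans ?_ (le_iSup _ (⟨i, hi⟩ : J)))
        refine le_sup_of_le_right (le_trans ?_ (le_iSup _ hik))
        exact le_partialSup a (Or.inr ⟨hi, le_refl i⟩)
    have hed : e ≤ d k := by
      rw [← liftSubobject_le_liftSubobject p, he, hd]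
      exact partialSup_mono a (Set.union_subset_union_right _ (Set.inter_subset_inter_right _
        Set.Iio_subset_Iic_self))
    have hfk : g ⊔ a k = f k := by
      refine le_antisymm (sup_le (partialSup_mono a (Set.union_subset_union_right _
        (Set.inter_subset_inter_right _ Set.Iio_subset_Iic_self)))
        (le_partialSup a (Or.inr ⟨k.2, le_refl _⟩))) (partialSup_le ?_)
      rintro i (hi | ⟨hi, hik⟩)
      · exact le_sup_of_le_left (le_partialSup a (Or.inl hi))
      · rcases lt_or_eq_of_le hik with h | rfl
        · exact le_sup_of_le_left (le_partialSup a (Or.inr ⟨hi, h⟩))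
        · exact le_sup_right
    -- An index already in `N` adds nothing; this zero quotient is why `S` must contain the zero
    -- objects.
    have hg : ∃ s, S s ∧ IsQuotient g (f k) s := by
      by_cases hk : (k : I) ∈ N
      · have : f k = g := by
          rw [← hfk, sup_eq_left]
          exact le_partialSup a (Or.inl hk)
        obtain ⟨Z, hZ⟩ := HasZeroObject.zero (C := A)
        exact ⟨Z, hS _ hZ, this ▸ isQuotient_self g hZ⟩
      · obtain ⟨s, hs, hq⟩ := ha k
        refine ⟨s, hs, ?_⟩
        rw [← hfk, isQuotient_sup_iff,
          inf_partialSup_eq (inf_iSup_le_of_linearOrder ·) hN hJ k.2 hk]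
        exact hq
    obtain ⟨s, hs, hq⟩ := hg
    have hq' := (isQuotient_cokernel hed).liftSubobject p
    rw [he, hd] at hq'
    obtain ⟨i⟩ := hq'.nonempty_iso hq
    exact ⟨s, hs, (isQuotient_cokernel hed).of_iso i⟩

/-- If the class `S` consists of `κ`-presentable objects and contains all `κ`-presentable objects
of `filt S`, then the algebras over a monad with carrier in `filt S` are filtered by the algebras
with carrier in `S`. -/
theorem filt_inverseImage_forget_of_filt {κ : Cardinal.{w}} [Fact κ.IsRegular]
    (hκ : Cardinal.aleph0 < κ) [IsCardinalLocallyPresentable A κ] {S : ObjectProperty A}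
    (hS : S ≤ isCardinalPresentable A κ) (hS' : filt S ⊓ isCardinalPresentable A κ ≤ S)
    (hS₀ : ∀ Z, IsZero Z → S Z) {T : Monad A} [PreservesColimitsOfSize.{w, w} T.toFunctor]
    (hT : PreservesPresentable T.toFunctor κ) {X : T.Algebra} (hX : filt S X.A) :
    filt (S.inverseImage T.forget) X := by
  obtain ⟨I, _, _, c, hc⟩ := exists_isFamilyFiltration hX
  choose s hs hq using hc.quotient
  -- The stages `c i` need not be small; the compact `a i` replace them in the lattice argument.
  choose a ha ha' ha'' using fun i => (hq i).exists_sup_eq (hS _ (hs i))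
  have hac (i : I) : partialSup a (Set.Iic i) = c i := by
    induction i using WellFoundedLT.induction with | _ i ih
    refine le_antisymm (partialSup_le fun j hj => ?_) ?_
    · exact (le_sup_right.trans (ha j).le).trans (hc.mono hj)
    · rw [← ha]
      refine sup_le (iSup₂_le fun j hj => ?_) (le_partialSup a (le_refl i))
      rw [← ih j hj]
      exact partialSup_mono a (Set.Iic_subset_Iic.2 hj.le)
  have hac' (i : I) : ⨆ j, ⨆ (_ : j < i), c j = partialSup a (Set.Iio i) := by
    refine le_antisymm (iSup₂_le fun j hj => ?_) (partialSup_le fun j hj => ?_)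
    · rw [← hac]
      exact partialSup_mono a fun k hk => lt_of_le_of_lt hk hj
    · exact (le_sup_right.trans (ha j).le).trans
        (le_iSup₂ (f := fun j (_ : j < i) => c j) j hj)
  have hquot (i : I) : ∃ s, S s ∧ IsQuotient (a i ⊓ partialSup a (Set.Iio i)) (a i) s := by
    refine ⟨s i, hs i, ?_⟩
    rw [← isQuotient_sup_iff, ← hac', ha]
    exact hq i
  have htop : ⨆ i, a i = ⊤ := by
    rw [← top_le_iff, ← hc.iSup_eq_top]
    refine iSup_le fun i => ?_
    rw [← hac]
    exact partialSup_le fun j _ => le_iSup a j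
  choose J hJ hJ' hiJ hJt using exists_isClosedFor_stable hκ (fun i => hac' i ▸ ha'' i) ha' htop
    (algebraImage X) (fun b hb => hb.algebraImage X hT) (fun t => by
      have := algebraImage_iSup_le X fun n : ULift.{w} ℕ => t n.down
      rwa [iSup_ulift, iSup_ulift] at this)
  -- The subalgebras attached to single indices need not increase with the index, so they are
  -- accumulated.
  let b (i : I) : Subobject X.A := ⨆ j : Set.Iic i, partialSup a (J j)
  have hb (i : I) : IsStable X (b i) :=
    IsStable.iSup X fun j : Set.Iic i => (isStable_iff X).2 (hJt j)
  have hle (i : I) : partialSup a (J i) ≤ b i :=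
    le_iSup (fun j : Set.Iic i => partialSup a (J j)) ⟨i, le_refl i⟩
  have hmono : Monotone b := fun i j hij => iSup_le fun k =>
    le_iSup (fun k : Set.Iic j => partialSup a (J k)) ⟨k, k.2.trans hij⟩
  let N (i : I) : Set I := ⋃ j : Set.Iio i, J j
  have hN (i : I) : ⨆ j, ⨆ (_ : j < i), b j = partialSup a (N i) := by
    rw [partialSup_iUnion]
    refine le_antisymm (iSup₂_le fun j hj => iSup_le fun k => ?_) (iSup_le fun j => ?_)
    · exact le_iSup (fun k : Set.Iio i => partialSup a (J k)) ⟨k, lt_of_le_of_lt k.2 hj⟩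
    · exact (hle j).trans (le_iSup₂ (f := fun j (_ : j < i) => b j) j.1 j.2)
  have hNJ (i : I) : b i = partialSup a (N i ∪ J i) := by
    rw [partialSup_union, partialSup_iUnion]
    refine le_antisymm (iSup_le fun j => ?_) (sup_le (iSup_le fun j => ?_) (hle i))
    · rcases lt_or_eq_of_le (show (j : I) ≤ i from j.2) with h | h
      · exact le_sup_of_le_left (le_iSup (fun k : Set.Iio i => partialSup a (J k)) ⟨j, h⟩)
      · rw [h]
        exact le_sup_right
    · exact (hle j).trans (hmono (le_of_lt j.2))
  have hbf : IsFamilyFiltration S b := by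
    refine ⟨hmono, ?_, fun i => ?_⟩
    · rw [← top_le_iff, ← htop]
      exact iSup_mono fun i => (le_partialSup a (hiJ i)).trans (hle i)
    · rw [hN, hNJ]
      obtain ⟨Q, d, hd, hQ⟩ := exists_isFamilyFiltration_partialSup hS₀ hquot
        (IsClosedFor.iUnion fun j : Set.Iio i => hJ' j) (hJ' i)
      have hd' : IsFamilyFiltration (isCardinalPresentable A κ) d :=
        ⟨hd.mono, hd.iSup_eq_top, fun k => by
          obtain ⟨s, hs, h⟩ := hd.quotient k
          exact ⟨s, hS _ hs, h⟩⟩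
      -- The filtration of `Q` along `J i` puts `Q` in `filt S`; since `J i` has fewer than `κ`
      -- elements, `Q` is also `κ`-presentable, hence in `S`.
      exact ⟨Q, hS' _ ⟨hd.filt, hd'.isCardinalPresentable (hJ i)⟩, hQ⟩
  obtain ⟨τ, Y, hY, hY'⟩ := hbf.exists_isFiltration
  refine filt_inverseImage_forget hY fun σ => ?_
  obtain ⟨K, hK⟩ := hY' σ
  rw [hK, iSup_subtype']
  exact IsStable.iSup X fun j : K => hb j

end Main

/-! ### Elementary closure properties of `filt` -/

section Closure

variable {A : Type u} [Category.{w} A] [Abelian A] [IsGrothendieckAbelian.{w} A]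

theorem isoClosure_le_filt (S : ObjectProperty A) : S.isoClosure ≤ filt S := by
  rintro X ⟨s, hs, ⟨e⟩⟩
  refine IsFamilyFiltration.filt (I := PUnit.{w + 1}) (c := fun _ => ⊤)
    ⟨fun _ _ _ => le_rfl, by simp, fun i => ⟨s, hs, ?_⟩⟩
  have h : ⨆ j, ⨆ (_ : j < i), (⊤ : Subobject X) = ⊥ :=
    bot_unique (iSup₂_le fun j hj => absurd hj (by simp))
  rw [h]
  refine ⟨bot_le, (⊤ : Subobject X).arrow ≫ e.hom, inferInstance, fun Z z => ?_⟩
  rw [Subobject.bot_factors_iff_zero, ← Category.assoc]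
  exact ⟨fun hz => by simpa using congr($hz ≫ e.inv), fun hz => by simp [hz]⟩

instance isClosedUnderIsomorphisms_filt (S : ObjectProperty A) :
    (filt S).IsClosedUnderIsomorphisms where
  of_iso e hX := filt_filt_le S _ (isoClosure_le_filt _ _ ⟨_, hX, ⟨e.symm⟩⟩)

theorem filt_of_isZero (S : ObjectProperty A) {Z : A} (hZ : IsZero Z) : filt S Z := by
  have h : (⊥ : Subobject Z) = ⊤ := by
    rw [eq_comm, ← Subobject.mk_eq_top_of_isIso (𝟙 Z), Subobject.mk_eq_bot_iff_zero]
    exact hZ.eq_of_src _ _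
  exact IsFamilyFiltration.filt (I := PEmpty.{w + 1}) (c := PEmpty.elim)
    ⟨fun i => i.elim, by rw [iSup_of_empty, h], fun i => i.elim⟩

end Closure

/-! ### Algebras with carrier in a filtered class; choice of the cardinal -/

section Monad

variable {A : Type u} [Category.{w} A] [Abelian A] [IsGrothendieckAbelian.{w} A]

instance hasColimitsOfSize_algebra (T : Monad A) [PreservesColimitsOfSize.{w, w} T.toFunctor] :
    HasColimitsOfSize.{w, w} T.Algebra :=
  ⟨fun _ _ => ⟨fun D => Monad.forget_creates_colimits_of_monad_preserves D⟩⟩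

instance preservesColimitsOfSize_forget (T : Monad A)
    [PreservesColimitsOfSize.{w, w} T.toFunctor] : PreservesColimitsOfSize.{w, w} T.forget :=
  ⟨fun {_} _ => inferInstance⟩

omit [Abelian A] [IsGrothendieckAbelian.{w} A] in
theorem small_inverseImage_forget (S : ObjectProperty A) [ObjectProperty.Small.{w} S]
    (T : Monad A) : ObjectProperty.Small.{w} (S.inverseImage T.forget) := by
  let φ : Subtype (S.inverseImage T.forget) → Σ s : Subtype S, (T.obj s.1 ⟶ s.1) :=
    fun X => ⟨⟨X.1.A, X.2⟩, X.1.a⟩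
  refine small_of_injective (f := φ) ?_
  rintro ⟨⟨X, x, hx, hx'⟩, hX⟩ ⟨⟨Y, y, hy, hy'⟩, hY⟩ h
  simp only [φ, Sigma.mk.injEq] at h
  obtain ⟨h₁, h⟩ := h
  obtain rfl : X = Y := congrArg Subtype.val h₁
  obtain rfl := eq_of_heq h
  rfl

theorem inverseImage_forget_eq_filt {κ : Cardinal.{w}} [Fact κ.IsRegular]
    (hκ : Cardinal.aleph0 < κ) [IsCardinalLocallyPresentable A κ] {F S : ObjectProperty A}
    {T : Monad A} [PreservesColimitsOfSize.{w, w} T.toFunctor]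
    (hS : IsRepresentativeSet S (F ⊓ isCardinalPresentable A κ)) (hF : F = filt S)
    (hT : PreservesPresentable T.toFunctor κ) :
    F.inverseImage T.forget = filt (S.inverseImage T.forget) := by
  have hFS : F ⊓ isCardinalPresentable A κ ≤ S.isoClosure := fun X hX => by
    obtain ⟨s, hs, e⟩ := hS.exists_iso X hX
    exact ⟨s, hs, e⟩
  apply le_antisymm
  · intro X hX
    -- The criterion is applied to `S.isoClosure`, since a representative set does not itself
    -- contain every `κ`-presentable object of `F`.
    refine filt_mono (isoClosure_inverseImage_forget_le T S) X
      (filt_inverseImage_forget_of_filt hκ ?_ ?_ (fun Z hZ => ?_) hT ?_)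
    · rintro X ⟨s, hs, ⟨e⟩⟩
      exact (isCardinalPresentable A κ).prop_of_iso e.symm (hS.le _ hs).2
    · rwa [filt_isoClosure, ← hF]
    · refine hFS _ ⟨?_, isCardinalPresentable_of_isZero hZ⟩
      rw [hF]
      exact filt_of_isZero S hZ
    · rw [filt_isoClosure, ← hF]
      exact hX
  · intro X hX
    change F (T.forget.obj X)
    rw [hF]
    exact filt_map T.forget (fun s hs => S.le_isoClosure _ hs) hX

omit [Abelian A] [IsGrothendieckAbelian.{w} A] in
theorem exists_isRepresentativeSet (P : ObjectProperty A) [ObjectProperty.EssentiallySmall.{w} P] :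
    ∃ S, IsRepresentativeSet S P := by
  obtain ⟨Q, _, hQP, hPQ⟩ := ObjectProperty.EssentiallySmall.exists_small_le.{w} P
  let r : Setoid (Subtype Q) :=
    ⟨fun X Y => Nonempty (X.1 ≅ Y.1), fun X => ⟨Iso.refl _⟩, fun ⟨e⟩ => ⟨e.symm⟩,
      fun ⟨e⟩ ⟨e'⟩ => ⟨e ≪≫ e'⟩⟩
  have : Small.{w} (Quotient r) := small_of_surjective Quotient.mk_surjective
  refine ⟨ObjectProperty.ofObj fun q : Quotient r => q.out.1, inferInstance, ?_, fun X hX => ?_, ?_⟩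
  · rintro _ ⟨q⟩
    exact hQP _ q.out.2
  · obtain ⟨Y, hY, ⟨e⟩⟩ := hPQ _ hX
    obtain ⟨e'⟩ : Nonempty ((Quotient.mk r ⟨Y, hY⟩).out.1 ≅ Y) := Quotient.mk_out (s := r) ⟨Y, hY⟩
    exact ⟨_, ⟨Quotient.mk r ⟨Y, hY⟩⟩, ⟨e ≪≫ e'.symm⟩⟩
  · rintro _ _ ⟨q⟩ ⟨q'⟩ h
    have : q = q' := by
      rw [← q.out_eq, ← q'.out_eq]
      exact Quotient.sound h
    rw [this]

/-- Take `κ` above the presentability ranks of the members of `S` and of the `T`-images of a strong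
generator. Every `κ`-presentable object is built from the generator by colimits of size less than
`κ`, which `T` preserves. -/
theorem exists_cardinal (S : ObjectProperty A) [ObjectProperty.Small.{w} S] (T : A ⥤ A)
    [PreservesColimitsOfSize.{w, w} T] (κ₀ : Cardinal.{w}) :
    ∃ (κ : Cardinal.{w}) (_ : Fact κ.IsRegular), κ₀ ≤ κ ∧ Cardinal.aleph0 < κ ∧
      IsCardinalLocallyPresentable A κ ∧ S ≤ isCardinalPresentable A κ ∧
      PreservesPresentable T κ := by
  have := isLocallyPresentable A
  obtain ⟨κ₁, _, _⟩ := IsLocallyPresentable.exists_cardinal A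
  obtain ⟨P, _, hP, hP'⟩ :=
    (IsCardinalLocallyPresentable.iff_exists_isStrongGenerator A κ₁).1 inferInstance
  let o : Subtype S ⊕ Subtype P → A := Sum.elim (fun X => X.1) (fun X => T.obj X.1)
  choose μ hμ ho using fun i => Functor.IsAccessible.exists_cardinal.{w}
    (F := coyoneda.obj (Opposite.op (o i)))
  let ν : Cardinal.{w} :=
    κ₀ ⊔ κ₁ ⊔ Cardinal.aleph0 ⊔ ⨆ i, μ ((equivShrink (Subtype S ⊕ Subtype P)).symm i)
  have hν : Cardinal.aleph0 ≤ ν := le_sup_of_le_left le_sup_right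
  have : Fact (Order.succ ν).IsRegular := ⟨Cardinal.isRegular_succ hν⟩
  have h₁ : κ₁ ≤ Order.succ ν :=
    (le_sup_of_le_left (le_sup_of_le_left le_sup_right)).trans (Order.le_succ ν)
  have h (i) : isCardinalPresentable A (Order.succ ν) (o i) := by
    refine isCardinalPresentable_monotone A (κ := μ i) ?_ _ (ho i)
    refine le_trans ?_ (Order.le_succ ν)
    obtain ⟨k, rfl⟩ := (equivShrink (Subtype S ⊕ Subtype P)).symm.surjective i
    exact le_sup_of_le_right (le_ciSup (Cardinal.bddAbove_of_small) k)
  refine ⟨Order.succ ν, inferInstance,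
    (le_sup_of_le_left (le_sup_of_le_left le_sup_left)).trans (Order.le_succ ν),
    hν.trans_lt (Order.lt_succ ν), IsCardinalLocallyPresentable.of_le A h₁,
    fun X hX => h (Sum.inl ⟨X, hX⟩), ?_⟩
  change isCardinalPresentable A (Order.succ ν) ≤
    (isCardinalPresentable A (Order.succ ν)).inverseImage T
  refine (IsStrongGenerator.colimitsCardinalClosure_eq_isCardinalPresentable hP
    (hP'.trans (isCardinalPresentable_monotone A h₁))).le.trans ?_
  refine P.colimitsCardinalClosure_le _ (fun J _ hJ => ?_) fun X hX => h (Sum.inr ⟨X, hX⟩)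
  have := isClosedUnderColimitsOfShape_isCardinalPresentable A hJ
  infer_instance

end Monad

/-! ### Transport along the comparison equivalence -/

section Monadic

variable {A : Type u} [Category.{w} A] [Abelian A] [IsGrothendieckAbelian.{w} A]
  {B : Type u'} [Category.{w} B] [Abelian B] [IsGrothendieckAbelian.{w} B] (U : B ⥤ A)
  [MonadicRightAdjoint U] [PreservesColimitsOfSize.{w, w} U]

instance preservesColimitsOfSize_monadicAdjunction :
    PreservesColimitsOfSize.{w, w} (monadicAdjunction U).toMonad.toFunctor :=
  have := (monadicAdjunction U).leftAdjoint_preservesColimits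
  inferInstanceAs (PreservesColimitsOfSize.{w, w} (monadicLeftAdjoint U ⋙ U))

/-- The comparison of the domain of a monadic functor with the category of algebras. -/
noncomputable def comparisonEquivalence : B ≌ (monadicAdjunction U).toMonad.Algebra :=
  (Monad.comparison (monadicAdjunction U)).asEquivalence

/-- The inverse of the comparison is compatible with the functors to the base category. -/
noncomputable def comparisonEquivalenceInverseIso (Y : (monadicAdjunction U).toMonad.Algebra) :
    U.obj ((comparisonEquivalence U).inverse.obj Y) ≅ Y.A :=
  (Monad.forget _).mapIso ((comparisonEquivalence U).counitIso.app Y)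

variable {U} {F S : ObjectProperty A}

theorem inverseImage_eq_filt_of_monadic (hF : F = filt S)
    (h : F.inverseImage (monadicAdjunction U).toMonad.forget =
      filt (S.inverseImage (monadicAdjunction U).toMonad.forget)) :
    F.inverseImage U = filt (S.isoClosure.inverseImage U) := by
  have : PreservesLimitsOfSize.{0, 0} U := (monadicAdjunction U).rightAdjoint_preservesLimits
  apply le_antisymm
  · intro X hX
    have h₁ : filt (S.inverseImage (monadicAdjunction U).toMonad.forget)
        ((comparisonEquivalence U).functor.obj X) := by
      rw [← h]
      exact hX
    have h₂ := filt_map (comparisonEquivalence U).inverse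
      (S' := S.isoClosure.inverseImage U) (fun Y hY => ObjectProperty.le_isoClosure _ _
        ⟨Y.A, hY, ⟨comparisonEquivalenceInverseIso U Y⟩⟩) h₁
    exact (filt _).prop_of_iso ((comparisonEquivalence U).unitIso.app X).symm h₂
  · intro X hX
    change F (U.obj X)
    rw [hF]
    exact filt_map U (fun s hs => hs) hX

omit [Abelian A] [IsGrothendieckAbelian.{w} A] [IsGrothendieckAbelian.{w} B]
  [PreservesColimitsOfSize.{w, w} U] in
-- The class in `h` is closed under isomorphism and need not be small. The objects of `B`
-- corresponding to algebras with carrier in `S` form a set that represents it.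
theorem isDeconstructible_inverseImage_of_monadic [ObjectProperty.Small.{w} S]
    (h : F.inverseImage U = filt (S.isoClosure.inverseImage U)) :
    IsDeconstructible (F.inverseImage U) := by
  have := small_inverseImage_forget S (monadicAdjunction U).toMonad
  refine ⟨ObjectProperty.ofObj
    fun Y : Subtype (S.inverseImage (monadicAdjunction U).toMonad.forget) =>
      (comparisonEquivalence U).inverse.obj Y.1, inferInstance, h.trans (le_antisymm ?_ ?_)⟩
  · refine filt_mono ?_
    rintro X ⟨s, hs, ⟨e⟩⟩
    obtain ⟨Z, hZ, ⟨i⟩⟩ := isoClosure_inverseImage_forget_le _ S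
      ((comparisonEquivalence U).functor.obj X) ⟨s, hs, ⟨e⟩⟩
    exact ⟨_, ⟨⟨Z, hZ⟩⟩, ⟨(comparisonEquivalence U).unitIso.app X ≪≫
      (comparisonEquivalence U).inverse.mapIso i⟩⟩
  · refine filt_mono (le_trans ?_ (ObjectProperty.le_isoClosure _))
    rintro _ ⟨Y⟩
    exact ⟨Y.1.A, Y.2, ⟨comparisonEquivalenceInverseIso U Y.1⟩⟩

end Monadic

end Deconstructible

theorem mainTheorem10 {A : Type u} [Category.{w} A] [Abelian A] [IsGrothendieckAbelian.{w} A] :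
    -- the precise form, for algebras over a cocontinuous monad
    (∀ (κ : Cardinal.{w}) [Fact κ.IsRegular], Cardinal.aleph0 < κ →
      IsCardinalLocallyPresentable A κ →
      ∀ (F S : ObjectProperty A) (T : Monad A) [PreservesColimitsOfSize.{w, w} T.toFunctor],
        Deconstructible.IsRepresentativeSet S (F ⊓ isCardinalPresentable A κ) →
        F = Deconstructible.filt S →
        Deconstructible.PreservesPresentable T.toFunctor κ →
        F.inverseImage T.forget = Deconstructible.filt (S.inverseImage T.forget) ∧
          Deconstructible.IsDeconstructible (F.inverseImage T.forget)) ∧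
    -- pulling back deconstructible classes along a cocontinuous monadic functor
    (∀ {B : Type u'} [Category.{w} B] [Abelian B] [IsGrothendieckAbelian.{w} B]
      (U : B ⥤ A) [MonadicRightAdjoint U] [PreservesColimitsOfSize.{w, w} U]
      (F : ObjectProperty A), Deconstructible.IsDeconstructible F →
        Deconstructible.IsDeconstructible (F.inverseImage U) ∧
        -- suitable cardinals exist, and are arbitrarily large
        ∀ κ₀ : Cardinal.{w}, ∃ (κ : Cardinal.{w}) (_ : Fact κ.IsRegular),
          κ₀ ≤ κ ∧ Cardinal.aleph0 < κ ∧ IsCardinalLocallyPresentable A κ ∧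
          Deconstructible.PreservesPresentable (monadicAdjunction U).toMonad.toFunctor κ ∧
          ∃ S : ObjectProperty A,
            Deconstructible.IsRepresentativeSet S (F ⊓ isCardinalPresentable A κ) ∧
            F = Deconstructible.filt S ∧
            F.inverseImage U = Deconstructible.filt (S.isoClosure.inverseImage U)) := by
  refine ⟨fun κ _ hκ _ F S T _ hS hF hT => ?_, fun {B} _ _ _ U _ _ F hF => ?_⟩
  · have h := Deconstructible.inverseImage_forget_eq_filt hκ hS hF hT
    have := hS.small
    exact ⟨h, _, Deconstructible.small_inverseImage_forget S T, h⟩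
  · have key (κ₀ : Cardinal.{w}) : ∃ (κ : Cardinal.{w}) (_ : Fact κ.IsRegular),
        κ₀ ≤ κ ∧ Cardinal.aleph0 < κ ∧ IsCardinalLocallyPresentable A κ ∧
        Deconstructible.PreservesPresentable (monadicAdjunction U).toMonad.toFunctor κ ∧
        ∃ S : ObjectProperty A,
          Deconstructible.IsRepresentativeSet S (F ⊓ isCardinalPresentable A κ) ∧
          F = Deconstructible.filt S ∧
          F.inverseImage U = Deconstructible.filt (S.isoClosure.inverseImage U) := by
      obtain ⟨S₀, _, hS₀⟩ := hF
      obtain ⟨κ, _, h₁, h₂, _, h₃, h₄⟩ :=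
        Deconstructible.exists_cardinal S₀ (monadicAdjunction U).toMonad.toFunctor κ₀
      have : ObjectProperty.EssentiallySmall.{w} (F ⊓ isCardinalPresentable A κ) :=
        .of_le inf_le_right
      obtain ⟨S, hS⟩ := Deconstructible.exists_isRepresentativeSet.{w}
        (F ⊓ isCardinalPresentable A κ)
      -- The generating set `S₀` lies in `F` and is `κ`-presentable, so up to isomorphism it lies in
      -- `S`; conversely `S ≤ F = filt S₀`, and `filt` is idempotent.
      have hFS : F = Deconstructible.filt S := by
        apply le_antisymm
        · rw [hS₀]
          refine Deconstructible.filt_mono fun X hX => ?_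
          obtain ⟨s, hs, e⟩ := hS.exists_iso X ⟨by
            rw [hS₀]
            exact Deconstructible.isoClosure_le_filt _ _ (S₀.le_isoClosure _ hX), h₃ _ hX⟩
          exact ⟨s, hs, e⟩
        · have h : S ≤ F := hS.le.trans inf_le_left
          have := Deconstructible.filt_mono (h.trans F.le_isoClosure)
          rw [hS₀] at this ⊢
          exact this.trans (Deconstructible.filt_filt_le S₀)
      exact ⟨κ, inferInstance, h₁, h₂, inferInstance, h₄, S, hS, hFS,
        Deconstructible.inverseImage_eq_filt_of_monadic hFS
          (Deconstructible.inverseImage_forget_eq_filt h₂ hS hFS h₄)⟩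
    refine ⟨?_, key⟩
    -- Any suitable cardinal serves here; the bound `0` imposes nothing.
    obtain ⟨κ, _, -, -, -, -, S, hS, -, h⟩ := key 0
    have := hS.small
    exact Deconstructible.isDeconstructible_inverseImage_of_monadic h
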